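/- **Setting.** A *signature* $\sigma=(\mathrm{Dom},\mathrm{Ran})$ consists of a nonempty finite set $\mathrm{Dom}$ of variables and a nonempty finite set $\mathrm{Ran}(X)$ of values for each $X\in\mathrm{Dom}$; $\mathrm{Ran}(\mathbf Z)$ denotes the set of tuples of values of the variables in $\mathbf Z\subseteq\mathrm{Dom}$. An *assignment* is a map $s$ with $s(X)\in\mathrm{Ran}(X)$ for all $X\in\mathrm{Dom}$. A *system of functions* $\mathcal F$ gives each variable $V$ in some set $\mathrm{En}(\mathcal F)\subseteq\mathrm{Dom}$ a set of parents $PA_V\subseteq\mathrm{Dom}\setminus\{V\}$ and a function $\mathcal F_V:\mathrm{Ran}(PA_V)\to\mathrm{Ran}(V)$. It is *recursive* if the graph with an edge from each parent of $V$ to $V$ ($V\in \mathrm{En}(\mathcal F)$) has no directed cycle. $\mathbb F_\sigma$ is the (finite) set of all systems of functions, and $\mathrm{Cn}(\mathcal F)$ is the set of $V\in\mathrm{En}(\mathcal F)$ with $\mathcal F_V$ constant. An assignment $s$ is *compatible* with $\mathcal F$ if $s(V)=\mathcal F_V(s(PA_V))$ for all $V\in\mathrm{En}(\mathcal F)$.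 A (recursive) *causal team* $T=(T^-,\mathcal F)$ is a set $T^-$ of assignments together with a recursive system $\mathcal F$ with which all of them are compatible. A *causal subteam* of $T$ has the same $\mathcal F$ and a subset of $T^-$. An *equation* $\mathbf X=\mathbf x$ is a finite conjunction $X_1=x_1\wedge\dots\wedge X_n=x_n$ with $x_i\in\mathrm{Ran}(X_i)$, considered up to the order of its conjuncts; it is *consistent* if it does not contain $X=x$ and $X=x'$ with $x\ne x'$. For consistent $\mathbf X=\mathbf x$, let $T_{\mathbf X=\mathbf x}=(\{s_{\mathbf X=\mathbf x}\mid s\in T^-\},\mathcal F_{\mathbf X=\mathbf x})$, where $\mathcal F_{\mathbf X=\mathbf x}$ is the restriction of $\mathcal F$ to $\mathrm{En}(\mathcal F)\setminus\mathbf X$ and, recursively, $s_{\mathbf X=\mathbf x}(V)$ is $x_i$ if $V=X_i$, is $s(V)$ if $V\notin\mathrm{En}(\mathcal F)\cup\mathbf X$, and is $\mathcal F_V(s_{\mathbf X=\mathbf x}(PA_V))$ otherwise. **Languages.** $\mathcal{CO}[\sigma]$: $\alpha::=X=x\mid\neg\alpha\mid\alpha\wedge\alpha\mid\alpha\vee\alpha\mid\mathbf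 X=\mathbf x\mathbin{\Box\!\!\to}\alpha$. Its extension $\mathcal{CO}_{⩔}[\sigma]$ by intuitionistic disjunction $⩔$: $\varphi::=X=x\mid\neg\alpha\mid\varphi\wedge\varphi\mid\varphi\vee\varphi\mid\varphi⩔\varphi\mid\mathbf X=\mathbf x\mathbin{\Box\!\!\to}\varphi$, where $\alpha\in\mathcal{CO}[\sigma]$. A counterfactual with empty antecedent is identified with its consequent. Abbreviations: $X\ne x:=\neg(X=x)$; $\bot:=X=x\wedge X\neq x$ for some fixed $X,x$; $\alpha\supset\varphi:=\neg\alpha\vee\varphi$; an empty disjunction is $\bot$ and an empty conjunction is $\neg\bot$. Finite conjunctions and disjunctions are formed in some fixed order. **Semantics.** $T\models X=x$ iff $s(X)=x$ for all $s\in T^-$; $T\models\neg\alpha$ iff $(\{s\},\mathcal F)\not\models\alpha$ for all $s\in T^-$; $T\models\varphi\wedge\psi$ iff $T\models\varphi$ and $T\models\psi$; $T\models\varphi\vee\psi$ iff there are causal subteams $T_1,T_2$ of $T$ with $T_1^-\cup T_2^-=T^-$, $T_1\models\varphi$ and $T_2\models\psi$; $T\models\varphi⩔\psi$ iff $T\models\varphi$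 or $T\models\psi$; $T\models\mathbf X=\mathbf x\mathbin{\Box\!\!\to}\varphi$ iff $\mathbf X=\mathbf x$ is inconsistent or $T_{\mathbf X=\mathbf x}\models\varphi$. For a set $\Gamma\cup\{\psi\}$ of $\mathcal{CO}_{⩔}[\sigma]$-formulas, $\Gamma\models^c\psi$ means that every (recursive) causal team over $\sigma$ that satisfies all formulas in $\Gamma$ satisfies $\psi$. **Deduction system.** $\Gamma\vdash^c\psi$ means that $\psi$ has a natural deduction derivation from assumptions in $\Gamma$ by the following rules. Here $\alpha$ ranges over $\mathcal{CO}[\sigma]$-formulas, $\varphi,\psi,\chi$ over $\mathcal{CO}_{⩔}[\sigma]$-formulas, $[\varphi]$ marks a discharged assumption, and $\mathbf X=\mathbf x$, $\mathbf Y=\mathbf y$ may be empty. * Value ranges: $\vdash\bigvee_{x\in\mathrm{Ran}(X)}X=x$; from $X=x$ infer $X\neq x'$ ($x\ne x'$). * $\wedge$I; $\wedge$E; $\vee$I; $\vee$E with conclusion $\alpha$ (from $\varphi\vee\psi$ and derivations of $\alpha$ from $[\varphi]$ and from $[\psi]$, infer $\alpha$); $\neg$I (from a derivation of $\bot$ from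 $[\alpha]$, infer $\neg\alpha$); $\neg$E (from $\alpha$ and $\neg\alpha$, infer $\varphi$); RAA (from a derivation of $\bot$ from $[\neg\alpha]$, infer $\alpha$). * Eff: $\vdash(\mathbf X=\mathbf x\wedge Y=y)\mathbin{\Box\!\!\to}Y=y$. * Cmp: from $\mathbf X=\mathbf x\mathbin{\Box\!\!\to}W=w$ and $\mathbf X=\mathbf x\mathbin{\Box\!\!\to}\gamma$, infer $(\mathbf X=\mathbf x\wedge W=w)\mathbin{\Box\!\!\to}\gamma$, where $\gamma$ is a $\mathcal{CO}_{⩔}[\sigma]$-formula without $\Box\!\!\to$. * $\Box\!\!\to\!\bot$E: from $\mathbf X=\mathbf x\mathbin{\Box\!\!\to}\bot$ with $\mathbf X=\mathbf x$ consistent, infer $\varphi$. $\;\bot\Box\!\!\to$E: $\vdash(\mathbf Y=\mathbf y\wedge X=x\wedge X=x')\mathbin{\Box\!\!\to}\varphi$ for $x\neq x'$. * Ctr, Wk: from either of $(X=x\wedge X=x\wedge\mathbf Y=\mathbf y)\mathbin{\Box\!\!\to}\varphi$ and $(X=x\wedge\mathbf Y=\mathbf y)\mathbin{\Box\!\!\to}\varphi$,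 infer the other. * Sub: from $\mathbf X=\mathbf x\mathbin{\Box\!\!\to}\varphi$ and a derivation of $\psi$ from $[\varphi]$ that has no other undischarged assumption, infer $\mathbf X=\mathbf x\mathbin{\Box\!\!\to}\psi$. * $\Box\!\!\to\!\wedge$I: from $\mathbf X=\mathbf x\mathbin{\Box\!\!\to}\varphi$ and $\mathbf X=\mathbf x\mathbin{\Box\!\!\to}\psi$, infer $\mathbf X=\mathbf x\mathbin{\Box\!\!\to}(\varphi\wedge\psi)$. $\;\Box\!\!\to\!\vee$Dst: from either of $\mathbf X=\mathbf x\mathbin{\Box\!\!\to}(\varphi\vee\psi)$ and $(\mathbf X=\mathbf x\mathbin{\Box\!\!\to}\varphi)\vee(\mathbf X=\mathbf x\mathbin{\Box\!\!\to}\psi)$, infer the other. * Extr: from $\mathbf X=\mathbf x\mathbin{\Box\!\!\to}(\mathbf Y=\mathbf y\mathbin{\Box\!\!\to}\varphi)$ with $\mathbf X=\mathbf x$ consistent, infer $(\mathbf X'=\mathbf x'\wedge\mathbf Y=\mathbf y)\mathbin{\Box\!\!\to}\varphi$, where $\mathbf X'=\mathbf x'$ consists of the conjuncts of $\mathbf X=\mathbf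 x$ whose variable is not in $\mathbf Y$. $\;$Exp: from $(\mathbf X=\mathbf x\wedge\mathbf Y=\mathbf y)\mathbin{\Box\!\!\to}\varphi$ with $\mathbf X\cap\mathbf Y=\emptyset$, infer $\mathbf X=\mathbf x\mathbin{\Box\!\!\to}(\mathbf Y=\mathbf y\mathbin{\Box\!\!\to}\varphi)$. * $\neg\Box\!\!\to$E: from $\neg(\mathbf X=\mathbf x\mathbin{\Box\!\!\to}\alpha)$, infer $\mathbf X=\mathbf x\mathbin{\Box\!\!\to}\neg\alpha$. * Recur: from $X_1\leadsto X_2,\dots,X_{k-1}\leadsto X_k$ with $k\ge2$ and $X_1,\dots,X_k$ pairwise distinct, infer $\neg(X_k\leadsto X_1)$. Here $X\leadsto Y$ is the disjunction of all $\mathbf Z=\mathbf z\mathbin{\Box\!\!\to}\big((X=x\mathbin{\Box\!\!\to}Y=y)\wedge(X=x'\mathbin{\Box\!\!\to}Y=y')\big)$ with $\mathbf Z\subseteq\mathrm{Dom}\setminus\{X,Y\}$, $\mathbf z\in\mathrm{Ran}(\mathbf Z)$, $x\ne x'$ in $\mathrm{Ran}(X)$ and $y\neq y'$ in $\mathrm{Ran}(Y)$.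 * Additional rules for $\vee$: from $\varphi\vee\psi$ infer $\psi\vee\varphi$; from $(\varphi\vee\psi)\vee\chi$ infer $\varphi\vee(\psi\vee\chi)$; from $\varphi\vee\psi$ and a derivation of $\chi$ from $[\varphi]$, infer $\chi\vee\psi$. * Rules for $⩔$: $⩔$I; $⩔$E (with arbitrary conclusion $\chi$); from $\varphi\vee(\psi⩔\chi)$ infer $(\varphi\vee\psi)⩔(\varphi\vee\chi)$; from $\mathbf X=\mathbf x\mathbin{\Box\!\!\to}(\psi⩔\chi)$ infer $(\mathbf X=\mathbf x\mathbin{\Box\!\!\to}\psi)⩔(\mathbf X=\mathbf x\mathbin{\Box\!\!\to}\chi)$. * The axiom Unf: the $⩔$-disjunction of the formulas $\Phi^{\mathcal F}$ over all $\mathcal F\in\mathbb F_\sigma$, where $\Phi^{\mathcal F}:=\bigwedge_{V\in\mathrm{En}(\mathcal F)}\eta(V)\wedge\bigwedge_{V\in(\mathrm{Dom}\setminus\mathrm{En}(\mathcal F))\cup\mathrm{Cn}(\mathcal F)}\xi(V)$. Here $\eta(V)$ is the conjunction of all $(\mathbf W=\mathbf w\wedge PA_V=\mathbf p)\mathbin{\Box\!\!\to}V=\mathcal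 F_V(\mathbf p)$ with $\mathbf W=\mathrm{Dom}\setminus(PA_V\cup\{V\})$, $\mathbf w\in\mathrm{Ran}(\mathbf W)$, $\mathbf p\in\mathrm{Ran}(PA_V)$, and $\xi(V)$ is the conjunction of all $V=v\supset(\mathbf W_V=\mathbf w\mathbin{\Box\!\!\to}V=v)$ with $v\in\mathrm{Ran}(V)$, $\mathbf W_V=\mathrm{Dom}\setminus\{V\}$, $\mathbf w\in\mathrm{Ran}(\mathbf W_V)$. **Theorem (soundness and completeness of $\mathcal{CO}_{⩔}[\sigma]$ over causal teams).** Let $\sigma$ be a signature and $\Gamma\cup\{\psi\}$ a set of $\mathcal{CO}_{⩔}[\sigma]$-formulas. Then $$\Gamma\models^c\psi\iff\Gamma\vdash^c\psi.$$ -/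

import Mathlib

universe u v

namespace CausalLogic

/-- A signature: a nonempty finite set of variables, each with a nonempty finite range. -/
structure Signature where
  Dom : Type u
  Ran : Dom → Type v
  [finDom : Finite Dom]
  [neDom : Nonempty Dom]
  [finRan : ∀ X, Finite (Ran X)]
  [neRan : ∀ X, Nonempty (Ran X)]

attribute [instance] Signature.finDom Signature.neDom Signature.finRan Signature.neRan

/-- Assignments `s` with `s X ∈ Ran X`. -/
abbrev Assignment (σ : Signature.{u, v}) := (X : σ.Dom) → σ.Ran X

/-! ### Systems of functions -/

/-- The data attached to an endogenous variable `V`: a set of parents not containing `V`, and a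
function from the tuples of values of the parents to `Ran V`. -/
structure Law (σ : Signature.{u, v}) (V : σ.Dom) where
  parents : Finset σ.Dom
  not_mem : V ∉ parents
  fn : ((X : parents) → σ.Ran X) → σ.Ran V

/-- A system of functions: a partial map on the variables (`none` on exogenous ones) that gives
each endogenous variable its parents and its function. -/
def SysFun (σ : Signature.{u, v}) := (V : σ.Dom) → Option (Law σ V)

instance (σ : Signature.{u, v}) (V : σ.Dom) : Finite (Law σ V) := by
  classical
  have : Function.Injective
      (fun f : Law σ V => (⟨f.parents, f.fn⟩ :
        Σ P : Finset σ.Dom, (((X : P) → σ.Ran X) → σ.Ran V))) := by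
    rintro ⟨P, hP, f⟩ ⟨Q, hQ, g⟩ h
    simp only [Sigma.mk.injEq] at h
    obtain ⟨rfl, h⟩ := h
    simp only [heq_eq_eq] at h
    subst h
    rfl
  exact Finite.of_injective _ this

instance (σ : Signature.{u, v}) : Finite (SysFun σ) :=
  inferInstanceAs (Finite ((V : σ.Dom) → Option (Law σ V)))

namespace SysFun

variable {σ : Signature.{u, v}}

/-- The endogenous variables. -/
def En (F : SysFun σ) : Set σ.Dom := {V | ∃ f, F V = some f}

/-- The endogenous variables whose function is constant. -/
def Cn (F : SysFun σ) : Set σ.Dom := {V | ∃ f, F V = some f ∧ ∃ c, ∀ p, f.fn p = c}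

/-- `(X, V)` is an edge of the graph of `F` when `X` is a parent of `V`. -/
def Edge (F : SysFun σ) (X V : σ.Dom) : Prop := ∃ f, F V = some f ∧ X ∈ f.parents

/-- `F` is recursive: its graph has no directed cycle. -/
def Recursive (F : SysFun σ) : Prop := ∀ V, ¬ Relation.TransGen F.Edge V V

/-- `s` is compatible with `F`. -/
def Compatible (F : SysFun σ) (s : Assignment σ) : Prop :=
  ∀ V f, F V = some f → s V = f.fn (fun X => s X)

theorem Recursive.wf {F : SysFun σ} (hF : F.Recursive) : WellFounded F.Edge := by
  have : Std.Irrefl (Relation.TransGen F.Edge) := ⟨hF⟩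
  exact Subrelation.wf (fun h => Relation.TransGen.single h)
    (Finite.wellFounded_of_trans_of_irrefl (Relation.TransGen F.Edge))

end SysFun

/-! ### Equations and interventions -/

/-- An atomic equation `X = x`. -/
abbrev Eqn (σ : Signature.{u, v}) := Σ X : σ.Dom, σ.Ran X

/-- A finite conjunction `X₁ = x₁ ∧ … ∧ Xₙ = xₙ` of equations, used as the antecedent of a
counterfactual; it is read up to the order, but not up to the repetition, of its conjuncts. -/
abbrev Eqns (σ : Signature.{u, v}) := Multiset (Eqn σ)

namespace Eqns

variable {σ : Signature.{u, v}}

/-- The set of variables occurring in a conjunction of equations. -/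
def vars (m : Eqns σ) : Set σ.Dom := {X | ∃ x, (⟨X, x⟩ : Eqn σ) ∈ m}

/-- No variable is equated with two distinct values. -/
def Consistent (m : Eqns σ) : Prop :=
  ∀ X x x', (⟨X, x⟩ : Eqn σ) ∈ m → (⟨X, x'⟩ : Eqn σ) ∈ m → x = x'

/-- The conjunction `Z = z`, for a set `Z` of variables and a tuple `z ∈ Ran(Z)`. -/
def ofTuple (Z : Finset σ.Dom) (z : (X : Z) → σ.Ran X) : Eqns σ :=
  Z.attach.val.map (fun X => ⟨X.1, z X⟩)

open Classical in
/-- The conjuncts of `m` whose variable does not occur in `n`. -/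
noncomputable def minus (m n : Eqns σ) : Eqns σ := m.filter (fun e => e.1 ∉ n.vars)

end Eqns

namespace SysFun

variable {σ : Signature.{u, v}}

open Classical in
/-- The restriction of `F` to the endogenous variables that do not occur in `m`. -/
noncomputable def intervene (F : SysFun σ) (m : Eqns σ) : SysFun σ :=
  fun V => if V ∈ m.vars then none else F V

theorem Recursive.intervene {F : SysFun σ} (hF : F.Recursive) (m : Eqns σ) :
    (F.intervene m).Recursive := by
  intro V h
  refine hF V (Relation.TransGen.mono ?_ V V h)
  rintro X W ⟨f, hf, hX⟩
  unfold SysFun.intervene at hf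
  split_ifs at hf
  exact ⟨f, hf, hX⟩

open Classical in
/-- The assignment `s_{X = x}`, by recursion along the graph of `F`. -/
noncomputable def doAssign (F : SysFun σ) (hF : F.Recursive) (m : Eqns σ) (s : Assignment σ) :
    Assignment σ :=
  hF.wf.fix (fun V ih =>
    if h : V ∈ m.vars then h.choose
    else match hV : F V with
      | none => s V
      | some f => f.fn (fun X => ih X ⟨f, hV, X.2⟩))

theorem doAssign_of_mem {F : SysFun σ} (hF : F.Recursive) {m : Eqns σ} (hm : m.Consistent)
    (s : Assignment σ) {V : σ.Dom} {x : σ.Ran V} (h : (⟨V, x⟩ : Eqn σ) ∈ m) :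
    F.doAssign hF m s V = x := by
  have h' : V ∈ m.vars := ⟨x, h⟩
  rw [doAssign, WellFounded.fix_eq, dif_pos h']
  exact hm V _ _ h'.choose_spec h

theorem doAssign_exogenous {F : SysFun σ} (hF : F.Recursive) {m : Eqns σ} (s : Assignment σ)
    {V : σ.Dom} (h : V ∉ m.vars) (hV : F V = none) : F.doAssign hF m s V = s V := by
  rw [doAssign, WellFounded.fix_eq, dif_neg h]
  split
  · rfl
  · rename_i f hf
    rw [hV] at hf
    cases hf

theorem doAssign_endogenous {F : SysFun σ} (hF : F.Recursive) {m : Eqns σ} (s : Assignment σ)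
    {V : σ.Dom} (h : V ∉ m.vars) {f : Law σ V} (hV : F V = some f) :
    F.doAssign hF m s V = f.fn (fun X => F.doAssign hF m s X) := by
  conv_lhs => rw [doAssign, WellFounded.fix_eq, dif_neg h]
  split
  · rename_i hf
    rw [hV] at hf
    cases hf
  · rename_i g hg
    rw [hV] at hg
    cases hg
    rfl

end SysFun

/-! ### Causal teams -/

/-- A (recursive) causal team: a set of assignments together with a recursive system of functions
with which they are all compatible. -/
structure CausalTeam (σ : Signature.{u, v}) where
  team : Set (Assignment σ)
  F : SysFun σ
  recursive : F.Recursive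
  compatible : ∀ s ∈ team, F.Compatible s

namespace CausalTeam

variable {σ : Signature.{u, v}}

/-- `S` is a causal subteam of `T`. -/
def IsSubteam (S T : CausalTeam σ) : Prop := S.team ⊆ T.team ∧ S.F = T.F

/-- The causal subteam `({s}, F)` of `T = (T⁻, F)`, for `s ∈ T⁻`. -/
def single (T : CausalTeam σ) (s : Assignment σ) (hs : s ∈ T.team) : CausalTeam σ where
  team := {s}
  F := T.F
  recursive := T.recursive
  compatible := by
    rintro t rfl
    exact T.compatible t hs

/-- The causal team `T_{X = x}` produced by the intervention `do(X = x)`. -/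
noncomputable def intervene (T : CausalTeam σ) (m : Eqns σ) : CausalTeam σ where
  team := T.F.doAssign T.recursive m '' T.team
  F := T.F.intervene m
  recursive := T.recursive.intervene m
  compatible := by
    rintro _ ⟨s, -, rfl⟩ V f hV
    unfold SysFun.intervene at hV
    split_ifs at hV with h
    exact SysFun.doAssign_endogenous T.recursive s h hV

end CausalTeam

/-! ### Formulas -/

/-- The two languages: the basic one, and its extension by the intuitionistic disjunction. -/
inductive Lang where
  | co
  | cov

/-- Formulas over `σ`. `Form σ .co` is the language of counterfactuals, and `Form σ .cov` its
extension by the intuitionistic disjunction `idisj`; negation is applied to formulas of the basic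
language only. The antecedent of a counterfactual is a nonempty conjunction of equations. -/
inductive Form (σ : Signature.{u, v}) : Lang → Type (max u v)
  | eq {L : Lang} (X : σ.Dom) (x : σ.Ran X) : Form σ L
  | neg {L : Lang} (α : Form σ Lang.co) : Form σ L
  | and {L : Lang} (φ ψ : Form σ L) : Form σ L
  | or {L : Lang} (φ ψ : Form σ L) : Form σ L
  | idisj (φ ψ : Form σ Lang.cov) : Form σ Lang.cov
  | cf {L : Lang} (m : Eqns σ) (hm : m ≠ 0) (φ : Form σ L) : Form σ L

namespace Form

variable {σ : Signature.{u, v}}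

/-- The inclusion of both languages into the larger one. -/
def lift : {L : Lang} → Form σ L → Form σ Lang.cov
  | _, eq X x => eq X x
  | _, neg α => neg α
  | _, and φ ψ => and φ.lift ψ.lift
  | _, or φ ψ => or φ.lift ψ.lift
  | _, idisj φ ψ => idisj φ ψ
  | _, cf m hm φ => cf m hm φ.lift

/-- Satisfaction of a formula in a causal team. -/
def Sat : {L : Lang} → Form σ L → CausalTeam σ → Prop
  | _, eq X x, T => ∀ s ∈ T.team, s X = x
  | _, neg α, T => ∀ (s : Assignment σ) (hs : s ∈ T.team), ¬ Sat α (T.single s hs)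
  | _, and φ ψ, T => Sat φ T ∧ Sat ψ T
  | _, or φ ψ, T => ∃ T₁ T₂ : CausalTeam σ, T₁.IsSubteam T ∧ T₂.IsSubteam T ∧
      T₁.team ∪ T₂.team = T.team ∧ Sat φ T₁ ∧ Sat ψ T₂
  | _, idisj φ ψ, T => Sat φ T ∨ Sat ψ T
  | _, cf m _ φ, T => ¬ m.Consistent ∨ Sat φ (T.intervene m)

/-- The formula contains no counterfactual. -/
def CfFree : {L : Lang} → Form σ L → Prop
  | _, eq _ _ => True
  | _, neg α => CfFree α
  | _, and φ ψ => CfFree φ ∧ CfFree ψ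
  | _, or φ ψ => CfFree φ ∧ CfFree ψ
  | _, idisj φ ψ => CfFree φ ∧ CfFree ψ
  | _, cf _ _ _ => False

variable {L : Lang}

open Classical in
/-- The counterfactual with a possibly empty antecedent: with the empty antecedent
(the intervention that changes nothing) it is its consequent. -/
noncomputable def boxr (m : Eqns σ) (φ : Form σ L) : Form σ L :=
  if hm : m = 0 then φ else cf m hm φ

/-- `⊥`, an abbreviation for `X = x ∧ X ≠ x`, where `X` and `x` are arbitrary but fixed. -/
noncomputable def bot : Form σ L :=
  and (eq (Classical.arbitrary σ.Dom) (Classical.arbitrary _))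
    (neg (eq (Classical.arbitrary σ.Dom) (Classical.arbitrary _)))

/-- Selective implication `α ⊃ φ`, an abbreviation for `¬ α ∨ φ`. -/
def selImp (α : Form σ Lang.co) (φ : Form σ L) : Form σ L := or (neg α) φ

/-- Conjunction of a finite list (the empty one is `¬ ⊥`). -/
noncomputable def listAnd : List (Form σ L) → Form σ L
  | [] => neg bot
  | [φ] => φ
  | φ :: ψ :: l => and φ (listAnd (ψ :: l))

/-- Disjunction of a finite list (the empty one is `⊥`). -/
noncomputable def listOr : List (Form σ L) → Form σ L
  | [] => bot
  | [φ] => φ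
  | φ :: ψ :: l => or φ (listOr (ψ :: l))

/-- Intuitionistic disjunction of a finite list (the empty one is `⊥`). -/
noncomputable def listIdisj : List (Form σ Lang.cov) → Form σ Lang.cov
  | [] => bot
  | [φ] => φ
  | φ :: ψ :: l => idisj φ (listIdisj (ψ :: l))

/-- An enumeration, without repetitions, of a finite type. -/
noncomputable def enum (ι : Type*) [Finite ι] : List ι :=
  (@Finset.univ ι (Fintype.ofFinite ι)).toList

/-- Conjunction of a finite family, in some fixed order. -/
noncomputable def bigAnd {ι : Type*} [Finite ι] (φ : ι → Form σ L) : Form σ L :=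
  listAnd ((enum ι).map φ)

/-- Disjunction of a finite family, in some fixed order. -/
noncomputable def bigOr {ι : Type*} [Finite ι] (φ : ι → Form σ L) : Form σ L :=
  listOr ((enum ι).map φ)

/-- Intuitionistic disjunction of a finite family, in some fixed order. -/
noncomputable def bigIdisj {ι : Type*} [Finite ι] (φ : ι → Form σ Lang.cov) : Form σ Lang.cov :=
  listIdisj ((enum ι).map φ)

/-- The parameters `(Z, z, x, x', y, y')` of the disjuncts of `X ⇝ Y`. -/
abbrev AffectsIndex (σ : Signature.{u, v}) (X Y : σ.Dom) :=
  {q : (Σ Z : Finset σ.Dom, ((V : Z) → σ.Ran V)) × (σ.Ran X × σ.Ran X) × (σ.Ran Y × σ.Ran Y) //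
    X ∉ q.1.1 ∧ Y ∉ q.1.1 ∧ q.2.1.1 ≠ q.2.1.2 ∧ q.2.2.1 ≠ q.2.2.2}

/-- `X ⇝ Y` (`X` causally affects `Y`): the disjunction of the formulas
`Z = z □→ ((X = x □→ Y = y) ∧ (X = x' □→ Y = y'))` with `Z ⊆ Dom \ {X, Y}`, `x ≠ x'`, `y ≠ y'`. -/
noncomputable def affects (X Y : σ.Dom) : Form σ L :=
  bigOr (fun q : AffectsIndex σ X Y =>
    boxr (Eqns.ofTuple q.1.1.1 q.1.1.2)
      (and (boxr {⟨X, q.1.2.1.1⟩} (eq Y q.1.2.2.1)) (boxr {⟨X, q.1.2.1.2⟩} (eq Y q.1.2.2.2))))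

open Classical in
/-- The conjunction of all `(W = w ∧ P = p) □→ V = f(p)`, where `P` is the set of parents of `V`
according to the law `f` of `V`, and `W = Dom \ (P ∪ {V})`. -/
noncomputable def eta {V : σ.Dom} (f : Law σ V) : Form σ L :=
  letI := Fintype.ofFinite σ.Dom
  let W : Finset σ.Dom := Finset.univ \ insert V f.parents
  bigAnd (fun q : ((X : W) → σ.Ran X) × ((X : f.parents) → σ.Ran X) =>
    boxr (Eqns.ofTuple W q.1 + Eqns.ofTuple f.parents q.2) (eq V (f.fn q.2)))

open Classical in
/-- The conjunction of all `V = v ⊃ (W = w □→ V = v)`, where `W = Dom \ {V}`. -/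
noncomputable def xi (V : σ.Dom) : Form σ L :=
  letI := Fintype.ofFinite σ.Dom
  let W : Finset σ.Dom := Finset.univ \ {V}
  bigAnd (fun q : σ.Ran V × ((X : W) → σ.Ran X) =>
    selImp (eq V q.1) (boxr (Eqns.ofTuple W q.2) (eq V q.1)))

/-- The formula `Φ^F`. -/
noncomputable def Phi (F : SysFun σ) : Form σ L :=
  and (bigAnd (fun V : F.En => eta V.2.choose))
    (bigAnd (fun V : ((F.En)ᶜ ∪ F.Cn : Set σ.Dom) => xi V.1))

/-- The formula `Unf`: the intuitionistic disjunction of all `Φ^F`. -/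
noncomputable def unf (σ : Signature.{u, v}) : Form σ Lang.cov :=
  bigIdisj (fun F : SysFun σ => Phi F)

end Form

/-! ### Natural deduction -/

open Form in
/-- `Derives A Γ φ`: the formula `φ` has a natural deduction derivation from undischarged
assumptions in `Γ`, in the system with the rules below and with the members of `A` as additional
axioms. In the rule `cfSub` the subderivation has no other undischarged assumption than `φ`. -/
inductive Derives {σ : Signature.{u, v}} (A : Set (Form σ Lang.cov)) :
    Set (Form σ Lang.cov) → Form σ Lang.cov → Prop
  | hyp {Γ φ} : φ ∈ Γ → Derives A Γ φ
  | ax {Γ φ} : φ ∈ A → Derives A Γ φ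
  -- value ranges
  | valDef {Γ} (X : σ.Dom) : Derives A Γ (bigOr (fun x : σ.Ran X => eq X x))
  | valUnq {Γ} {X : σ.Dom} {x x' : σ.Ran X} : x ≠ x' →
      Derives A Γ (eq X x) → Derives A Γ (neg (eq X x'))
  -- conjunction, disjunction, negation
  | andI {Γ φ ψ} : Derives A Γ φ → Derives A Γ ψ → Derives A Γ (and φ ψ)
  | andE₁ {Γ φ ψ} : Derives A Γ (and φ ψ) → Derives A Γ φ
  | andE₂ {Γ φ ψ} : Derives A Γ (and φ ψ) → Derives A Γ ψ
  | orI₁ {Γ φ ψ} : Derives A Γ φ → Derives A Γ (or φ ψ)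
  | orI₂ {Γ φ ψ} : Derives A Γ φ → Derives A Γ (or ψ φ)
  | orE {Γ φ ψ} {α : Form σ Lang.co} : Derives A Γ (or φ ψ) →
      Derives A (insert φ Γ) α.lift → Derives A (insert ψ Γ) α.lift → Derives A Γ α.lift
  | negI {Γ} {α : Form σ Lang.co} : Derives A (insert α.lift Γ) bot → Derives A Γ (neg α)
  | negE {Γ φ} {α : Form σ Lang.co} : Derives A Γ α.lift → Derives A Γ (neg α) → Derives A Γ φ
  | raa {Γ} {α : Form σ Lang.co} : Derives A (insert (neg α) Γ) bot → Derives A Γ α.lift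
  -- counterfactuals
  | cfEff {Γ} (m : Eqns σ) (Y : σ.Dom) (y : σ.Ran Y) :
      Derives A Γ (boxr (m + {⟨Y, y⟩}) (eq Y y))
  | cfCmp {Γ γ} {m : Eqns σ} {W : σ.Dom} {w : σ.Ran W} : γ.CfFree →
      Derives A Γ (boxr m (eq W w)) → Derives A Γ (boxr m γ) →
      Derives A Γ (boxr (m + {⟨W, w⟩}) γ)
  | cfBotE {Γ φ} {m : Eqns σ} : m.Consistent → Derives A Γ (boxr m bot) → Derives A Γ φ
  | botCf {Γ φ} (m : Eqns σ) {X : σ.Dom} {x x' : σ.Ran X} : x ≠ x' →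
      Derives A Γ (boxr (m + {⟨X, x⟩} + {⟨X, x'⟩}) φ)
  | cfCtr {Γ φ} {e : Eqn σ} {m : Eqns σ} :
      Derives A Γ (boxr ({e} + {e} + m) φ) → Derives A Γ (boxr ({e} + m) φ)
  | cfWk {Γ φ} {e : Eqn σ} {m : Eqns σ} :
      Derives A Γ (boxr ({e} + m) φ) → Derives A Γ (boxr ({e} + {e} + m) φ)
  | cfSub {Γ φ ψ} {m : Eqns σ} : Derives A Γ (boxr m φ) → Derives A {φ} ψ →
      Derives A Γ (boxr m ψ)
  | cfAndI {Γ φ ψ} {m : Eqns σ} : Derives A Γ (boxr m φ) → Derives A Γ (boxr m ψ) →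
      Derives A Γ (boxr m (and φ ψ))
  | cfOrDst {Γ φ ψ} {m : Eqns σ} : Derives A Γ (boxr m (or φ ψ)) →
      Derives A Γ (or (boxr m φ) (boxr m ψ))
  | cfOrDstInv {Γ φ ψ} {m : Eqns σ} : Derives A Γ (or (boxr m φ) (boxr m ψ)) →
      Derives A Γ (boxr m (or φ ψ))
  | cfExtr {Γ φ} {m n : Eqns σ} : m.Consistent → Derives A Γ (boxr m (boxr n φ)) →
      Derives A Γ (boxr (m.minus n + n) φ)
  | cfExp {Γ φ} {m n : Eqns σ} : Disjoint m.vars n.vars → Derives A Γ (boxr (m + n) φ) →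
      Derives A Γ (boxr m (boxr n φ))
  | negCfE {Γ} {m : Eqns σ} {α : Form σ Lang.co} : Derives A Γ (neg (boxr m α)) →
      Derives A Γ (boxr m (neg α))
  | recur {Γ} {k : ℕ} {X : Fin (k + 2) → σ.Dom} : Function.Injective X →
      (∀ i : Fin (k + 1), Derives A Γ (affects (X i.castSucc) (X i.succ))) →
      Derives A Γ (neg (affects (X (Fin.last (k + 1))) (X 0)))
  -- additional rules for disjunction
  | orCom {Γ φ ψ} : Derives A Γ (or φ ψ) → Derives A Γ (or ψ φ)
  | orAss {Γ φ ψ χ} : Derives A Γ (or (or φ ψ) χ) → Derives A Γ (or φ (or ψ χ))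
  | orSub {Γ φ ψ χ} : Derives A Γ (or φ ψ) → Derives A (insert φ Γ) χ → Derives A Γ (or χ ψ)
  -- intuitionistic disjunction
  | idisjI₁ {Γ φ ψ} : Derives A Γ φ → Derives A Γ (idisj φ ψ)
  | idisjI₂ {Γ φ ψ} : Derives A Γ φ → Derives A Γ (idisj ψ φ)
  | idisjE {Γ φ ψ χ} : Derives A Γ (idisj φ ψ) → Derives A (insert φ Γ) χ →
      Derives A (insert ψ Γ) χ → Derives A Γ χ
  | orIdisjDst {Γ φ ψ χ} : Derives A Γ (or φ (idisj ψ χ)) →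
      Derives A Γ (idisj (or φ ψ) (or φ χ))
  | cfIdisjDst {Γ ψ χ} {m : Eqns σ} : Derives A Γ (boxr m (idisj ψ χ)) →
      Derives A Γ (idisj (boxr m ψ) (boxr m χ))

/-- Derivability in the system for generalized causal teams extended with the axiom `Unf`. -/
def DerivesC {σ : Signature.{u, v}} (Γ : Set (Form σ Lang.cov)) (ψ : Form σ Lang.cov) : Prop :=
  Derives {Form.unf σ} Γ ψ

/-- Semantic consequence over recursive causal teams. -/
def EntailsC {σ : Signature.{u, v}} (Γ : Set (Form σ Lang.cov)) (ψ : Form σ Lang.cov) : Prop :=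
  ∀ T : CausalTeam σ, (∀ φ ∈ Γ, φ.Sat T) → ψ.Sat T

end CausalLogic

/-!
Soundness is an induction on derivations. It rests on downward closure of satisfaction
(`Form.Sat.mono`), flatness of the basic language (`Form.sat_of_forall_single`), the composition law
for interventions (`CausalTeam.intervene_intervene`) and, for the rule `recur`, on the fact that a
difference in the value of `Y` caused by different values of `X` travels along a directed path
(`Form.transGen_of_sat_affects`).

For completeness, every formula is provably equivalent to an intuitionistic disjunction of formulas
of the basic language (`Derives.exists_normalForm`). There are finitely many causal teams, so the
assumptions can be replaced by one formula, hence, by elimination of intuitionistic disjunctions, by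
one formula `α` of the basic language; the axiom `Unf` adds a formula `Φ^F`. The largest causal team
that satisfies `α` and has the laws of `F` picks out one disjunct `β` of the conclusion, which then
follows from `α` over all teams with these laws.

It remains to derive `β` from `Φ^F` and `α`, a classical problem. A case distinction on the values
of all variables after all interventions (`Derives.of_forall_table`) reduces it to assumptions that
decide these values. The composition rule, together with the formulas `η` and `ξ` in `Φ^F`, shows
that the table of values is the one computed by the laws of `F`
(`Derives.table_eq_doAssign`), and the truth lemma (`Derives.truth`) extends this to all formulas of
the basic language. Since `F` need not be recursive, it is replaced throughout by the system
`SysFun.reduce F`, which keeps only the parents on which the laws really depend: each of its edges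
is a provable instance of `X ⇝ Y` (`Derives.affects_of_Phi`), so that the rule `recur` refutes
`Φ^F` if there is a directed cycle (`Derives.bot_of_not_recursive`).
-/

namespace CausalLogic

variable {σ : Signature.{u, v}}

/-! ### Interventions -/

namespace Eqns

theorem Consistent.mono {m n : Eqns σ} (hn : n.Consistent) (h : ∀ e ∈ m, e ∈ n) :
    m.Consistent :=
  fun X x x' hx hx' => hn X x x' (h _ hx) (h _ hx')

theorem consistent_zero : (0 : Eqns σ).Consistent :=
  fun _ _ _ hx => absurd hx (Multiset.notMem_zero _)

theorem mem_minus {m n : Eqns σ} {e : Eqn σ} : e ∈ m.minus n ↔ e ∈ m ∧ e.1 ∉ n.vars := by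
  classical
  unfold minus
  rw [Multiset.mem_filter]

theorem vars_add {m n : Eqns σ} : (m + n).vars = m.vars ∪ n.vars := by
  ext V
  simp only [vars, Set.mem_ofPred_eq, Set.mem_union, Multiset.mem_add, exists_or]

theorem vars_minus_add {m n : Eqns σ} : (m.minus n + n).vars = m.vars ∪ n.vars := by
  ext V
  by_cases hV : V ∈ n.vars
  · simp [vars_add, hV]
  · simp only [vars_add, Set.mem_union, hV, or_false]
    simp only [vars, Set.mem_ofPred_eq, mem_minus]
    exact ⟨fun ⟨x, hx⟩ => ⟨x, hx.1⟩, fun ⟨x, hx⟩ => ⟨x, hx, hV⟩⟩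

theorem Consistent.minus_add {m n : Eqns σ} (hm : m.Consistent) (hn : n.Consistent) :
    (m.minus n + n).Consistent := by
  intro X x x' hx hx'
  rw [Multiset.mem_add, mem_minus] at hx hx'
  rcases hx with ⟨hx, h⟩ | hx <;> rcases hx' with ⟨hx', h'⟩ | hx'
  · exact hm X x x' hx hx'
  · exact absurd ⟨x', hx'⟩ h
  · exact absurd ⟨x, hx⟩ h'
  · exact hn X x x' hx hx'

theorem minus_eq_self {m n : Eqns σ} (h : Disjoint m.vars n.vars) : m.minus n = m := by
  classical
  unfold minus
  rw [Multiset.filter_eq_self]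
  exact fun e he => Set.disjoint_left.mp h ⟨e.2, he⟩

theorem mem_ofTuple {Z : Finset σ.Dom} {z : (X : Z) → σ.Ran X} {e : Eqn σ} :
    e ∈ ofTuple Z z ↔ ∃ h : e.1 ∈ Z, z ⟨e.1, h⟩ = e.2 := by
  unfold ofTuple
  rw [Multiset.mem_map]
  constructor
  · rintro ⟨X, -, rfl⟩
    exact ⟨X.2, rfl⟩
  · rintro ⟨h, he⟩
    exact ⟨⟨e.1, h⟩, Finset.mem_attach _ _, by rw [he]⟩

theorem mem_ofTuple_restrict {Z : Finset σ.Dom} {s : Assignment σ} {e : Eqn σ} :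
    e ∈ ofTuple Z (fun X => s X) ↔ e.1 ∈ Z ∧ s e.1 = e.2 := by
  rw [mem_ofTuple]
  exact ⟨fun ⟨h, he⟩ => ⟨h, he⟩, fun ⟨h, he⟩ => ⟨h, he⟩⟩

theorem vars_ofTuple {Z : Finset σ.Dom} {z : (X : Z) → σ.Ran X} : (ofTuple Z z).vars = ↑Z := by
  ext V
  simp only [vars, Set.mem_ofPred_eq, mem_ofTuple, Finset.mem_coe]
  exact ⟨fun ⟨_, h, _⟩ => h, fun h => ⟨z ⟨V, h⟩, h, rfl⟩⟩

theorem consistent_ofTuple {Z : Finset σ.Dom} {z : (X : Z) → σ.Ran X} :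
    (ofTuple Z z).Consistent := by
  intro X x x' hx hx'
  obtain ⟨_, h⟩ := mem_ofTuple.mp hx
  obtain ⟨_, h'⟩ := mem_ofTuple.mp hx'
  exact h.symm.trans h'

theorem Consistent.add {m n : Eqns σ} (hm : m.Consistent) (hn : n.Consistent)
    (h : Disjoint m.vars n.vars) : (m + n).Consistent := by
  simpa only [minus_eq_self h] using hm.minus_add hn

theorem exists_of_not_consistent {m : Eqns σ} (h : ¬ m.Consistent) :
    ∃ (X : σ.Dom) (x x' : σ.Ran X) (n : Eqns σ), x ≠ x' ∧ m = n + {⟨X, x⟩} + {⟨X, x'⟩} := by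
  unfold Consistent at h
  push Not at h
  obtain ⟨X, x, x', hx, hx', hne⟩ := h
  obtain ⟨n, rfl⟩ := Multiset.exists_cons_of_mem hx'
  obtain hx | hx := Multiset.mem_cons.mp hx
  · simp only [Sigma.mk.injEq, heq_eq_eq, true_and] at hx
    exact absurd hx hne
  · obtain ⟨k, rfl⟩ := Multiset.exists_cons_of_mem hx
    refine ⟨X, x, x', k, hne, ?_⟩
    rw [add_comm k, add_comm, Multiset.singleton_add, Multiset.singleton_add]

theorem not_consistent_of_ne {m : Eqns σ} {X : σ.Dom} {x x' : σ.Ran X} (h : x ≠ x') :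
    ¬ (m + {⟨X, x⟩} + {⟨X, x'⟩}).Consistent := fun hc =>
  h (hc X x x' (by simp) (by simp))

end Eqns

namespace SysFun

/-- An assignment solving the defining equations of the intervened assignment is equal to it. -/
theorem eq_doAssign {F : SysFun σ} (hF : F.Recursive) {m : Eqns σ} (hm : m.Consistent)
    {s t : Assignment σ} (h_mem : ∀ V x, (⟨V, x⟩ : Eqn σ) ∈ m → t V = x)
    (h_exo : ∀ V ∉ m.vars, F V = none → t V = s V)
    (h_end : ∀ V ∉ m.vars, ∀ f, F V = some f → t V = f.fn (fun X => t X)) :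
    t = F.doAssign hF m s := by
  funext V
  induction V using hF.wf.induction with
  | _ V ih =>
    by_cases hV : V ∈ m.vars
    · obtain ⟨x, hx⟩ := hV
      rw [doAssign_of_mem hF hm s hx, h_mem V x hx]
    · cases hf : F V with
      | none => rw [doAssign_exogenous hF s hV hf, h_exo V hV hf]
      | some f =>
        rw [doAssign_endogenous hF s hV hf, h_end V hV f hf]
        congr 1
        funext X
        exact ih X ⟨f, hf, X.2⟩

theorem intervene_of_mem {F : SysFun σ} {m : Eqns σ} {V : σ.Dom} (h : V ∈ m.vars) :
    F.intervene m V = none := by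
  simp [SysFun.intervene, h]

theorem intervene_of_notMem {F : SysFun σ} {m : Eqns σ} {V : σ.Dom} (h : V ∉ m.vars) :
    F.intervene m V = F V := by
  simp [SysFun.intervene, h]

theorem intervene_intervene (F : SysFun σ) (m n : Eqns σ) :
    (F.intervene m).intervene n = F.intervene (m.minus n + n) := by
  funext V
  unfold SysFun.intervene
  rw [Eqns.vars_minus_add]
  by_cases hm : V ∈ m.vars <;> by_cases hn : V ∈ n.vars <;> simp [hm, hn]

theorem doAssign_doAssign {F : SysFun σ} (hF : F.Recursive) {m n : Eqns σ} (hm : m.Consistent)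
    (hn : n.Consistent) (s : Assignment σ) :
    (F.intervene m).doAssign (hF.intervene m) n (F.doAssign hF m s) =
      F.doAssign hF (m.minus n + n) s := by
  refine eq_doAssign hF (hm.minus_add hn) ?_ ?_ ?_
  · intro V x hx
    rw [Multiset.mem_add, Eqns.mem_minus] at hx
    rcases hx with ⟨hx, h⟩ | hx
    · rw [doAssign_exogenous _ _ h (intervene_of_mem ⟨x, hx⟩), doAssign_of_mem hF hm s hx]
    · exact doAssign_of_mem _ hn _ hx
  · intro V hV hf
    rw [Eqns.vars_minus_add, Set.mem_union, not_or] at hV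
    rw [doAssign_exogenous _ _ hV.2 (by rwa [intervene_of_notMem hV.1]),
      doAssign_exogenous hF s hV.1 hf]
  · intro V hV f hf
    rw [Eqns.vars_minus_add, Set.mem_union, not_or] at hV
    rw [doAssign_endogenous _ _ hV.2 (by rwa [intervene_of_notMem hV.1])]

theorem doAssign_zero {F : SysFun σ} (hF : F.Recursive) {s : Assignment σ} (hs : F.Compatible s) :
    F.doAssign hF 0 s = s :=
  (eq_doAssign hF Eqns.consistent_zero (fun _ _ h => absurd h (Multiset.notMem_zero _))
    (fun _ _ _ => rfl) (fun V _ f hf => hs V f hf)).symm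

/-- Adding to an intervention an equation that already holds after it does not change the
resulting assignment. -/
theorem doAssign_add_singleton {F : SysFun σ} (hF : F.Recursive) {m : Eqns σ} {W : σ.Dom}
    {w : σ.Ran W} (hm : (m + {⟨W, w⟩}).Consistent) {s : Assignment σ}
    (hw : F.doAssign hF m s W = w) :
    F.doAssign hF (m + {⟨W, w⟩}) s = F.doAssign hF m s := by
  have hm' : m.Consistent := hm.mono (fun e he => Multiset.mem_add.mpr (Or.inl he))
  refine (eq_doAssign hF hm ?_ ?_ ?_).symm
  · intro V x hx
    rcases Multiset.mem_add.mp hx with hx | hx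
    · exact doAssign_of_mem hF hm' s hx
    · obtain ⟨rfl, hx⟩ := Sigma.mk.inj_iff.mp (Multiset.mem_singleton.mp hx)
      rw [hw, eq_of_heq hx]
  · intro V hV hf
    rw [Eqns.vars_add, Set.mem_union, not_or] at hV
    exact doAssign_exogenous hF s hV.1 hf
  · intro V hV f hf
    rw [Eqns.vars_add, Set.mem_union, not_or] at hV
    exact doAssign_endogenous hF s hV.1 hf

/-- Two interventions on the same variables, whose equations agree except on `X`, produce the same
value at every variable that is not reachable from `X` in the causal graph. -/
theorem doAssign_congr_of_not_reachable {F : SysFun σ} (hF : F.Recursive) {m n : Eqns σ}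
    (hm : m.Consistent) (hn : n.Consistent) (hvars : m.vars = n.vars) (s : Assignment σ)
    {X : σ.Dom} (h : ∀ e : Eqn σ, e.1 ≠ X → (e ∈ m ↔ e ∈ n)) {V : σ.Dom} (hVX : V ≠ X)
    (hV : ¬ Relation.TransGen F.Edge X V) :
    F.doAssign hF m s V = F.doAssign hF n s V := by
  induction V using hF.wf.induction with
  | _ V ih =>
    by_cases hVm : V ∈ m.vars
    · obtain ⟨x, hx⟩ := hVm
      rw [doAssign_of_mem hF hm s hx, doAssign_of_mem hF hn s ((h ⟨V, x⟩ hVX).mp hx)]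
    · have hVn : V ∉ n.vars := hvars ▸ hVm
      cases hf : F V with
      | none => rw [doAssign_exogenous hF s hVm hf, doAssign_exogenous hF s hVn hf]
      | some f =>
        rw [doAssign_endogenous hF s hVm hf, doAssign_endogenous hF s hVn hf]
        congr 1
        funext Y
        have hY : F.Edge Y V := ⟨f, hf, Y.2⟩
        refine ih Y hY ?_ fun hXY => hV (hXY.tail hY)
        intro hYX
        exact hV (Relation.TransGen.single (hYX ▸ hY))

end SysFun

/-! ### Causal teams -/

namespace CausalTeam

theorem ext_team {S T : CausalTeam σ} (h : S.team = T.team) (hF : S.F = T.F) : S = T := by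
  cases S
  cases T
  cases h
  cases hF
  rfl

instance : Finite (CausalTeam σ) := by
  refine Finite.of_injective (fun T => (T.team, T.F)) ?_
  intro S T h
  simp only [Prod.mk.injEq] at h
  exact ext_team h.1 h.2

theorem IsSubteam.refl (T : CausalTeam σ) : T.IsSubteam T := ⟨subset_rfl, rfl⟩

theorem IsSubteam.trans {R S T : CausalTeam σ} (h : R.IsSubteam S) (h' : S.IsSubteam T) :
    R.IsSubteam T := ⟨h.1.trans h'.1, h.2.trans h'.2⟩

theorem single_isSubteam {T : CausalTeam σ} {s : Assignment σ} (hs : s ∈ T.team) :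
    (T.single s hs).IsSubteam T := ⟨Set.singleton_subset_iff.mpr hs, rfl⟩

/-- The causal subteam of `T` with the assignments that belong to `A`. -/
def restrict (T : CausalTeam σ) (A : Set (Assignment σ)) : CausalTeam σ where
  team := T.team ∩ A
  F := T.F
  recursive := T.recursive
  compatible s hs := T.compatible s hs.1

theorem restrict_isSubteam (T : CausalTeam σ) (A : Set (Assignment σ)) :
    (T.restrict A).IsSubteam T := ⟨Set.inter_subset_left, rfl⟩

theorem IsSubteam.intervene {S T : CausalTeam σ} (h : S.IsSubteam T) (m : Eqns σ) :
    (S.intervene m).IsSubteam (T.intervene m) := by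
  obtain ⟨A, F, hF, hA⟩ := S
  obtain ⟨B, F', hF', hB⟩ := T
  obtain ⟨h, rfl⟩ := h
  exact ⟨Set.image_mono h, rfl⟩

theorem intervene_intervene (T : CausalTeam σ) {m n : Eqns σ} (hm : m.Consistent)
    (hn : n.Consistent) : (T.intervene m).intervene n = T.intervene (m.minus n + n) := by
  refine ext_team ?_ (SysFun.intervene_intervene _ _ _)
  simp only [CausalTeam.intervene, Set.image_image]
  refine Set.image_congr fun s _ => ?_
  exact SysFun.doAssign_doAssign T.recursive hm hn s

theorem intervene_zero (T : CausalTeam σ) : T.intervene 0 = T := by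
  refine ext_team ?_ ?_
  · simp only [CausalTeam.intervene]
    conv_rhs => rw [← Set.image_id T.team]
    exact Set.image_congr fun s hs => SysFun.doAssign_zero T.recursive (T.compatible s hs)
  · funext V
    refine SysFun.intervene_of_notMem ?_
    rintro ⟨x, hx⟩
    exact Multiset.notMem_zero _ hx

theorem intervene_congr (T : CausalTeam σ) {m n : Eqns σ} (hm : m.Consistent)
    (h : ∀ e, e ∈ m ↔ e ∈ n) : T.intervene m = T.intervene n := by
  have hvars : m.vars = n.vars := by
    ext V
    simp only [Eqns.vars, Set.mem_ofPred_eq, h]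
  refine ext_team ?_ ?_
  · refine Set.image_congr fun s _ => ?_
    refine SysFun.eq_doAssign T.recursive (hm.mono fun e he => (h e).mpr he) ?_ ?_ ?_
    · exact fun V x hx => SysFun.doAssign_of_mem _ hm _ ((h _).mpr hx)
    · exact fun V hV hf => SysFun.doAssign_exogenous _ _ (hvars ▸ hV) hf
    · exact fun V hV f hf => SysFun.doAssign_endogenous _ _ (hvars ▸ hV) hf
  · funext V
    change T.F.intervene m V = T.F.intervene n V
    unfold SysFun.intervene
    rw [hvars]

theorem single_intervene {T : CausalTeam σ} {s : Assignment σ} (hs : s ∈ T.team) (m : Eqns σ) :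
    (T.single s hs).intervene m =
      (T.intervene m).single (T.F.doAssign T.recursive m s) (Set.mem_image_of_mem _ hs) :=
  ext_team Set.image_singleton rfl

/-- `T` consists of a single assignment. -/
def IsPoint (T : CausalTeam σ) : Prop := ∃ s, T.team = {s}

theorem isPoint_single {T : CausalTeam σ} {s : Assignment σ} (hs : s ∈ T.team) :
    (T.single s hs).IsPoint := ⟨s, rfl⟩

theorem IsPoint.single_eq {T : CausalTeam σ} (h : T.IsPoint) {s : Assignment σ}
    (hs : s ∈ T.team) : T.single s hs = T := by
  obtain ⟨t, ht⟩ := h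
  obtain rfl : s = t := by rwa [ht] at hs
  exact ext_team ht.symm rfl

end CausalTeam

/-! ### Satisfaction -/

namespace Form

variable {L : Lang}

theorem sat_of_empty : {L : Lang} → (φ : Form σ L) → {T : CausalTeam σ} → T.team = ∅ → φ.Sat T
  | _, eq X x, T, h => by simp [Sat, h]
  | _, neg α, T, h => by simp [Sat, h]
  | _, and φ ψ, T, h => ⟨sat_of_empty φ h, sat_of_empty ψ h⟩
  | _, or φ ψ, T, h => ⟨T, T, .refl T, .refl T, Set.union_self _, sat_of_empty φ h,
      sat_of_empty ψ h⟩
  | _, idisj φ ψ, T, h => Or.inl (sat_of_empty φ h)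
  | _, cf m hm φ, T, h => Or.inr (sat_of_empty φ (by simp [CausalTeam.intervene, h]))

theorem Sat.mono : {L : Lang} → {φ : Form σ L} → {S T : CausalTeam σ} → φ.Sat T →
    S.IsSubteam T → φ.Sat S
  | _, eq X x, S, T, h, hST => fun s hs => h s (hST.1 hs)
  | _, neg α, S, T, h, hST => fun s hs hα => h s (hST.1 hs) <| by
      have : T.single s (hST.1 hs) = S.single s hs := CausalTeam.ext_team rfl hST.2.symm
      rwa [this]
  | _, and φ ψ, S, T, h, hST => ⟨Sat.mono h.1 hST, Sat.mono h.2 hST⟩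
  | _, or φ ψ, S, T, h, hST => by
      obtain ⟨T₁, T₂, h₁, h₂, hu, hφ, hψ⟩ := h
      refine ⟨T₁.restrict S.team, T₂.restrict S.team, ⟨Set.inter_subset_right, ?_⟩,
        ⟨Set.inter_subset_right, ?_⟩, ?_, Sat.mono hφ (T₁.restrict_isSubteam _),
        Sat.mono hψ (T₂.restrict_isSubteam _)⟩
      · exact h₁.2.trans hST.2.symm
      · exact h₂.2.trans hST.2.symm
      · simp only [CausalTeam.restrict, ← Set.union_inter_distrib_right, hu]
        exact Set.inter_eq_right.mpr hST.1
  | _, idisj φ ψ, S, T, h, hST => h.imp (fun h => Sat.mono h hST) (fun h => Sat.mono h hST)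
  | _, cf m hm φ, S, T, h, hST => h.imp id (fun h => Sat.mono h (hST.intervene m))

theorem sat_or_of_subset {φ ψ : Form σ L} {T : CausalTeam σ} (A B : Set (Assignment σ))
    (h : T.team ⊆ A ∪ B) (hφ : φ.Sat (T.restrict A)) (hψ : ψ.Sat (T.restrict B)) :
    (or φ ψ).Sat T :=
  ⟨_, _, T.restrict_isSubteam A, T.restrict_isSubteam B, by
    simp only [CausalTeam.restrict, ← Set.inter_union_distrib_left, Set.inter_eq_left.mpr h],
    hφ, hψ⟩

theorem sat_or_inl {φ ψ : Form σ L} {T : CausalTeam σ} (h : φ.Sat T) : (or φ ψ).Sat T :=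
  sat_or_of_subset Set.univ ∅ (by simp) (h.mono (T.restrict_isSubteam _))
    (sat_of_empty _ (Set.inter_empty _))

theorem sat_or_comm {φ ψ : Form σ L} {T : CausalTeam σ} (h : (or φ ψ).Sat T) :
    (or ψ φ).Sat T := by
  obtain ⟨T₁, T₂, h₁, h₂, hu, hφ, hψ⟩ := h
  exact ⟨T₂, T₁, h₂, h₁, Set.union_comm _ _ ▸ hu, hψ, hφ⟩

theorem sat_neg_iff {α : Form σ Lang.co} {T : CausalTeam σ} (hT : T.IsPoint) :
    (neg α : Form σ L).Sat T ↔ ¬ α.Sat T := by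
  simp only [Sat]
  constructor
  · intro h
    obtain ⟨s, hs⟩ := hT
    have hs' : s ∈ T.team := hs ▸ Set.mem_singleton s
    have := h s hs'
    rwa [CausalTeam.IsPoint.single_eq ⟨s, hs⟩] at this
  · intro h s hs
    rwa [hT.single_eq]

theorem sat_or_iff {φ ψ : Form σ L} {T : CausalTeam σ} (hT : T.IsPoint) :
    (or φ ψ).Sat T ↔ φ.Sat T ∨ ψ.Sat T := by
  constructor
  · obtain ⟨s, hs⟩ := hT
    rintro ⟨T₁, T₂, h₁, h₂, hu, hφ, hψ⟩
    have : s ∈ T₁.team ∪ T₂.team := by rw [hu, hs]; rfl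
    refine this.imp (fun h => hφ.mono ⟨?_, h₁.2.symm⟩) (fun h => hψ.mono ⟨?_, h₂.2.symm⟩)
    · rw [hs]; exact Set.singleton_subset_iff.mpr h
    · rw [hs]; exact Set.singleton_subset_iff.mpr h
  · rintro (h | h)
    · exact sat_or_inl h
    · exact sat_or_comm (sat_or_inl h)

/-- Formulas of the basic language are flat: they hold in a team as soon as they hold at each of
its assignments. -/
theorem sat_of_forall_single : {α : Form σ Lang.co} → {T : CausalTeam σ} →
    (∀ s hs, α.Sat (T.single s hs)) → α.Sat T
  | eq X x, T, h => fun s hs => h s hs s rfl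
  | neg α, T, h => fun s hs => by
      have := h s hs
      rwa [sat_neg_iff (CausalTeam.isPoint_single hs)] at this
  | and α β, T, h => ⟨sat_of_forall_single fun s hs => (h s hs).1,
      sat_of_forall_single fun s hs => (h s hs).2⟩
  | or α β, T, h => by
      refine sat_or_of_subset {s | ∃ hs, α.Sat (T.single s hs)} {s | ∃ hs, β.Sat (T.single s hs)}
        ?_ (sat_of_forall_single ?_) (sat_of_forall_single ?_)
      · intro s hs
        exact ((sat_or_iff (CausalTeam.isPoint_single hs)).mp (h s hs)).imp
          (fun h => ⟨hs, h⟩) (fun h => ⟨hs, h⟩)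
      · rintro s ⟨_, hs, h⟩
        exact h
      · rintro s ⟨_, hs, h⟩
        exact h
  | cf m hm α, T, h => by
      by_cases hc : m.Consistent
      · refine Or.inr (sat_of_forall_single ?_)
        rintro _ ⟨s, hs, rfl⟩
        have := (h s hs).resolve_left (not_not.mpr hc)
        rwa [CausalTeam.single_intervene hs] at this
      · exact Or.inl hc

theorem sat_lift : {L : Lang} → {φ : Form σ L} → {T : CausalTeam σ} → (φ.lift.Sat T ↔ φ.Sat T)
  | _, eq X x, T => Iff.rfl
  | _, neg α, T => Iff.rfl
  | _, and φ ψ, T => and_congr sat_lift sat_lift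
  | _, or φ ψ, T => by simp only [lift, Sat, sat_lift]
  | _, idisj φ ψ, T => Iff.rfl
  | _, cf m hm φ, T => or_congr Iff.rfl sat_lift

theorem sat_bot {T : CausalTeam σ} : (bot : Form σ L).Sat T ↔ T.team = ∅ := by
  constructor
  · rintro ⟨h, h'⟩
    by_contra hne
    obtain ⟨s, hs⟩ := Set.nonempty_iff_ne_empty.mpr hne
    refine h' s hs ?_
    intro t ht
    rw [Set.mem_singleton_iff.mp ht]
    exact h s hs
  · exact sat_of_empty _

/-- With the empty antecedent included, a counterfactual is satisfied when its antecedent is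
inconsistent or its consequent is satisfied after the intervention. -/
theorem sat_boxr {m : Eqns σ} {φ : Form σ L} {T : CausalTeam σ} :
    (boxr m φ).Sat T ↔ (m.Consistent → φ.Sat (T.intervene m)) := by
  unfold boxr
  split_ifs with hm
  · subst hm
    simp [CausalTeam.intervene_zero, Eqns.consistent_zero]
  · simp only [Sat, imp_iff_not_or]

theorem sat_boxr_congr {m n : Eqns σ} (h : ∀ e, e ∈ m ↔ e ∈ n) {φ : Form σ L}
    {T : CausalTeam σ} (hs : (boxr m φ).Sat T) : (boxr n φ).Sat T := by
  rw [sat_boxr] at hs ⊢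
  intro hn
  have hm : m.Consistent := hn.mono fun e he => (h e).mp he
  rw [← T.intervene_congr hm h]
  exact hs hm

/-- A formula without counterfactuals does not depend on the system of functions. -/
theorem sat_congr_of_cfFree : {L : Lang} → {φ : Form σ L} → φ.CfFree → {S T : CausalTeam σ} →
    S.team = T.team → φ.Sat S → φ.Sat T
  | _, eq X x, _, S, T, h, hS => by simpa only [Sat, h] using hS
  | _, neg α, hα, S, T, h, hS => fun s hs hT =>
      hS s (h ▸ hs)
      (sat_congr_of_cfFree (φ := α) hα (S := T.single s hs) (T := S.single s (h ▸ hs)) rfl hT)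
  | _, and φ ψ, hφ, S, T, h, hS =>
      ⟨sat_congr_of_cfFree (φ := φ) hφ.1 h hS.1, sat_congr_of_cfFree (φ := ψ) hφ.2 h hS.2⟩
  | _, or φ ψ, hφ, S, T, h, hS => by
      obtain ⟨T₁, T₂, h₁, h₂, hu, hs₁, hs₂⟩ := hS
      have hT : ∀ {R : CausalTeam σ}, R.IsSubteam S → R.team = (T.restrict R.team).team :=
        fun hR => (Set.inter_eq_right.mpr (h ▸ hR.1)).symm
      refine sat_or_of_subset T₁.team T₂.team (by rw [hu, h])
        (sat_congr_of_cfFree (φ := φ) hφ.1 (hT h₁) hs₁)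
        (sat_congr_of_cfFree (φ := ψ) hφ.2 (hT h₂) hs₂)
  | _, idisj φ ψ, hφ, S, T, h, hS => hS.imp (sat_congr_of_cfFree (φ := φ) hφ.1 h)
      (sat_congr_of_cfFree (φ := ψ) hφ.2 h)

theorem sat_listAnd {l : List (Form σ L)} {T : CausalTeam σ} (h : ∀ φ ∈ l, φ.Sat T) :
    (listAnd l).Sat T := by
  match l with
  | [] =>
    intro s hs hb
    rw [sat_bot] at hb
    exact Set.singleton_ne_empty _ hb
  | [φ] => exact h φ (by simp)
  | φ :: ψ :: l =>
    exact ⟨h φ (by simp), sat_listAnd (l := ψ :: l) fun χ hχ => h χ (List.mem_cons_of_mem _ hχ)⟩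

theorem sat_listOr_iff {l : List (Form σ L)} {T : CausalTeam σ} (hT : T.IsPoint) :
    (listOr l).Sat T ↔ ∃ φ ∈ l, φ.Sat T := by
  match l with
  | [] =>
    obtain ⟨s, hs⟩ := hT
    simp [listOr, sat_bot, hs]
  | [φ] => simp [listOr]
  | φ :: ψ :: l =>
    rw [listOr, sat_or_iff hT, sat_listOr_iff (l := ψ :: l) hT]
    simp

theorem sat_listIdisj {l : List (Form σ Lang.cov)} {T : CausalTeam σ} {φ : Form σ Lang.cov}
    (hφ : φ ∈ l) (h : φ.Sat T) : (listIdisj l).Sat T := by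
  match l with
  | [ψ] => rwa [List.mem_singleton.mp hφ] at h
  | ψ :: χ :: l =>
    rcases List.mem_cons.mp hφ with rfl | hφ
    · exact Or.inl h
    · exact Or.inr (sat_listIdisj hφ h)

theorem exists_sat_of_sat_listIdisj {l : List (Form σ Lang.cov)} (hl : l ≠ [])
    {T : CausalTeam σ} (h : (listIdisj l).Sat T) : ∃ φ ∈ l, φ.Sat T := by
  match l with
  | [ψ] => exact ⟨ψ, by simp, h⟩
  | ψ :: χ :: l =>
    rcases h with h | h
    · exact ⟨ψ, by simp, h⟩
    · obtain ⟨φ, hφ, h⟩ := exists_sat_of_sat_listIdisj (l := χ :: l) (by simp) h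
      exact ⟨φ, List.mem_cons_of_mem _ hφ, h⟩

theorem mem_enum {ι : Type*} [Finite ι] (i : ι) : i ∈ enum ι := by
  simp [enum]

theorem sat_bigAnd {ι : Type*} [Finite ι] {φ : ι → Form σ L} {T : CausalTeam σ}
    (h : ∀ i, (φ i).Sat T) : (bigAnd φ).Sat T :=
  sat_listAnd fun χ hχ => by
    obtain ⟨i, -, rfl⟩ := List.mem_map.mp hχ
    exact h i

theorem sat_bigOr_iff {ι : Type*} [Finite ι] {φ : ι → Form σ L} {T : CausalTeam σ}
    (hT : T.IsPoint) : (bigOr φ).Sat T ↔ ∃ i, (φ i).Sat T := by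
  rw [bigOr, sat_listOr_iff hT]
  simp [mem_enum]

theorem lift_boxr (m : Eqns σ) (φ : Form σ L) : (boxr m φ).lift = boxr m φ.lift := by
  unfold boxr
  split_ifs <;> rfl

theorem lift_cov : (φ : Form σ Lang.cov) → φ.lift = φ
  | eq X x => rfl
  | neg α => rfl
  | and φ ψ => congrArg₂ and (lift_cov φ) (lift_cov ψ)
  | or φ ψ => congrArg₂ or (lift_cov φ) (lift_cov ψ)
  | idisj φ ψ => rfl
  | cf m hm φ => congrArg (cf m hm) (lift_cov φ)

theorem lift_listOr (l : List (Form σ L)) : (listOr l).lift = listOr (l.map lift) := by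
  match l with
  | [] => rfl
  | [φ] => rfl
  | φ :: ψ :: l => exact congrArg (or φ.lift) (lift_listOr (ψ :: l))

theorem lift_bigOr {ι : Type*} [Finite ι] (φ : ι → Form σ L) :
    (bigOr φ).lift = bigOr (fun i => (φ i).lift) := by
  rw [bigOr, lift_listOr, List.map_map]
  rfl

theorem lift_affects (X Y : σ.Dom) : (affects X Y : Form σ L).lift = affects X Y := by
  unfold affects
  rw [lift_bigOr]
  simp only [lift_boxr, lift]

/-- Flatness along the inclusion of the basic language into the extended one. -/
theorem sat_lift_of_forall_single {α : Form σ Lang.co} {T : CausalTeam σ}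
    (h : ∀ s hs, α.lift.Sat (T.single s hs)) : α.lift.Sat T :=
  sat_lift.mpr (sat_of_forall_single fun s hs => sat_lift.mp (h s hs))

/-- At a single assignment, `X ⇝ Y` yields a directed path from `X` to `Y`. -/
theorem transGen_of_sat_affects {X Y : σ.Dom} (hXY : X ≠ Y) {T : CausalTeam σ} (hT : T.IsPoint)
    (h : (affects X Y : Form σ L).Sat T) : Relation.TransGen T.F.Edge X Y := by
  rw [affects, sat_bigOr_iff hT] at h
  obtain ⟨⟨⟨⟨Z, z⟩, ⟨x, x'⟩, ⟨y, y'⟩⟩, hXZ, hYZ, hx, hy⟩, h⟩ := h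
  simp only at hXZ hYZ hx hy h
  rw [sat_boxr] at h
  obtain ⟨h₁, h₂⟩ := h Eqns.consistent_ofTuple
  have hsing : ∀ a : σ.Ran X, ({⟨X, a⟩} : Eqns σ).Consistent := by
    intro a W w w' hw hw'
    have := (Multiset.mem_singleton.mp hw).trans (Multiset.mem_singleton.mp hw').symm
    exact eq_of_heq (Sigma.mk.inj_iff.mp this).2
  have hvars : ∀ a : σ.Ran X, ({⟨X, a⟩} : Eqns σ).vars = {X} := by
    intro a
    ext V
    simp only [Eqns.vars, Set.mem_ofPred_eq, Multiset.mem_singleton, Set.mem_singleton_iff]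
    constructor
    · rintro ⟨w, hw⟩
      exact (Sigma.mk.inj_iff.mp hw).1
    · rintro rfl
      exact ⟨a, rfl⟩
  have hdisj : ∀ a : σ.Ran X, Disjoint (Eqns.ofTuple Z z).vars ({⟨X, a⟩} : Eqns σ).vars := by
    intro a
    rw [hvars, Eqns.vars_ofTuple, Set.disjoint_singleton_right]
    exact hXZ
  have key : ∀ (a : σ.Ran X) (b : σ.Ran Y),
      (boxr {⟨X, a⟩} (eq Y b) : Form σ L).Sat (T.intervene (Eqns.ofTuple Z z)) →
      ∀ s ∈ T.team, T.F.doAssign T.recursive (Eqns.ofTuple Z z + {⟨X, a⟩}) s Y = b := by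
    intro a b hab s hs
    rw [sat_boxr] at hab
    have := hab (hsing a)
    rw [T.intervene_intervene Eqns.consistent_ofTuple (hsing a),
      Eqns.minus_eq_self (hdisj a)] at this
    exact this _ (Set.mem_image_of_mem _ hs)
  obtain ⟨s, hs⟩ := hT
  have hs' : s ∈ T.team := hs ▸ Set.mem_singleton s
  by_contra hno
  refine hy ((key x y h₁ s hs').symm.trans (Eq.trans ?_ (key x' y' h₂ s hs')))
  refine SysFun.doAssign_congr_of_not_reachable T.recursive
    (Eqns.consistent_ofTuple.add (hsing x) (hdisj x))
    (Eqns.consistent_ofTuple.add (hsing x') (hdisj x')) ?_ s ?_ hXY.symm hno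
  · rw [Eqns.vars_add, Eqns.vars_add, hvars, hvars]
  · intro e he
    simp only [Multiset.mem_add, Multiset.mem_singleton]
    refine or_congr Iff.rfl ⟨?_, ?_⟩ <;> rintro rfl <;> exact absurd rfl he

end Form

/-! ### Soundness -/

theorem SysFun.choose_eq {F : SysFun σ} {V : σ.Dom} (hV : V ∈ F.En)
    {f : Law σ V} (hf : F V = some f) : hV.choose = f :=
  Option.some_injective _ (hV.choose_spec.symm.trans hf)

namespace Form

variable {L : Lang}

theorem sat_eta {T : CausalTeam σ} {V : σ.Dom} {f : Law σ V} (hf : T.F V = some f) :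
    (eta f : Form σ L).Sat T := by
  classical
  let _ := Fintype.ofFinite σ.Dom
  refine sat_bigAnd fun q => sat_boxr.mpr fun hc => ?_
  rintro _ ⟨s, hs, rfl⟩
  rw [SysFun.doAssign_endogenous T.recursive s ?_ hf]
  · congr 1
    funext X
    exact SysFun.doAssign_of_mem T.recursive hc s
      (Multiset.mem_add.mpr (Or.inr (Eqns.mem_ofTuple.mpr ⟨X.2, rfl⟩)))
  · rw [Eqns.vars_add, Eqns.vars_ofTuple, Eqns.vars_ofTuple]
    simp [f.not_mem]

theorem sat_xi {T : CausalTeam σ} {V : σ.Dom} (hV : V ∈ (T.F.Enᶜ ∪ T.F.Cn : Set σ.Dom)) :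
    (xi V : Form σ L).Sat T := by
  classical
  let _ := Fintype.ofFinite σ.Dom
  refine sat_bigAnd fun q => ?_
  refine sat_or_of_subset {s | s V ≠ q.1} {s | s V = q.1} (fun s _ => (em (s V = q.1)).symm) ?_ ?_
  · intro s hs hq
    exact hs.2 (hq s rfl)
  · refine sat_boxr.mpr fun hc => ?_
    rintro _ ⟨s, hs, rfl⟩
    have hVm : V ∉ (Eqns.ofTuple _ q.2).vars := by
      rw [Eqns.vars_ofTuple]
      simp
    change T.F.doAssign T.recursive _ s V = q.1
    rcases hV with hV | ⟨f, hf, c, hfc⟩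
    · have hnone : T.F V = none := by
        rw [Option.eq_none_iff_forall_ne_some]
        exact fun f hf => hV ⟨f, hf⟩
      rw [SysFun.doAssign_exogenous T.recursive s hVm hnone]
      exact hs.2
    · rw [SysFun.doAssign_endogenous T.recursive s hVm hf, hfc, ← hfc (fun X => s X)]
      exact (T.compatible s hs.1 V f hf).symm.trans hs.2

theorem sat_Phi (T : CausalTeam σ) : (Phi T.F : Form σ L).Sat T :=
  ⟨sat_bigAnd fun V => sat_eta V.2.choose_spec, sat_bigAnd fun V => sat_xi V.2⟩

/-- The disjunct of `Unf` for the system of functions of `T` holds in `T`. -/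
theorem sat_unf (T : CausalTeam σ) : (unf σ).Sat T :=
  sat_listIdisj (List.mem_map.mpr ⟨T.F, mem_enum _, rfl⟩) (sat_Phi T)

theorem sat_insert {Γ : Set (Form σ Lang.cov)} {φ : Form σ Lang.cov} {S T : CausalTeam σ}
    (hΓ : ∀ χ ∈ Γ, χ.Sat T) (hST : S.IsSubteam T) (h : φ.Sat S) :
    ∀ χ ∈ insert φ Γ, χ.Sat S := by
  rintro χ (rfl | hχ)
  · exact h
  · exact (hΓ χ hχ).mono hST

end Form

open Form

/-- Soundness: derivations preserve satisfaction in recursive causal teams. -/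
theorem Derives.sound {A Γ : Set (Form σ Lang.cov)} {ψ : Form σ Lang.cov} (h : Derives A Γ ψ)
    (hA : ∀ φ ∈ A, ∀ T, φ.Sat T) {T : CausalTeam σ} (hT : ∀ φ ∈ Γ, φ.Sat T) : ψ.Sat T := by
  induction h generalizing T with
  | hyp h => exact hT _ h
  | ax h => exact hA _ h T
  | valDef X =>
    have : ((bigOr (fun x : σ.Ran X => (eq X x : Form σ Lang.co))).lift).Sat T := by
      refine sat_lift_of_forall_single fun s hs => ?_
      rw [sat_lift, sat_bigOr_iff (CausalTeam.isPoint_single hs)]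
      exact ⟨s X, fun t ht => congrFun (Set.mem_singleton_iff.mp ht) X⟩
    rwa [lift_bigOr] at this
  | valUnq hne _ ih =>
    intro s hs h
    exact hne ((ih hT s hs).symm.trans (h s rfl))
  | andI _ _ ih₁ ih₂ => exact ⟨ih₁ hT, ih₂ hT⟩
  | andE₁ _ ih => exact (ih hT).1
  | andE₂ _ ih => exact (ih hT).2
  | orI₁ _ ih => exact sat_or_inl (ih hT)
  | orI₂ _ ih => exact sat_or_comm (sat_or_inl (ih hT))
  | orE _ _ _ ih ih₁ ih₂ =>
    obtain ⟨T₁, T₂, h₁, h₂, hu, hφ, hψ⟩ := ih hT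
    refine sat_lift_of_forall_single fun s hs => ?_
    have hs' : s ∈ T₁.team ∪ T₂.team := hu ▸ hs
    rcases hs' with hs' | hs'
    · exact (ih₁ (sat_insert hT h₁ hφ)).mono ⟨Set.singleton_subset_iff.mpr hs', h₁.2.symm⟩
    · exact (ih₂ (sat_insert hT h₂ hψ)).mono ⟨Set.singleton_subset_iff.mpr hs', h₂.2.symm⟩
  | negI _ ih =>
    intro s hs h
    have := ih (sat_insert hT (CausalTeam.single_isSubteam hs) (sat_lift.mpr h))
    exact Set.singleton_ne_empty s (sat_bot.mp this)
  | negE _ _ ih₁ ih₂ =>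
    refine sat_of_empty _ (Set.eq_empty_iff_forall_notMem.mpr fun s hs => ?_)
    exact ih₂ hT s hs ((sat_lift.mp (ih₁ hT)).mono (CausalTeam.single_isSubteam hs))
  | raa _ ih =>
    refine sat_lift_of_forall_single fun s hs => ?_
    by_contra h
    rw [sat_lift, ← sat_neg_iff (L := Lang.cov) (CausalTeam.isPoint_single hs)] at h
    have := ih (sat_insert hT (CausalTeam.single_isSubteam hs) h)
    exact Set.singleton_ne_empty s (sat_bot.mp this)
  | cfEff m Y y =>
    refine sat_boxr.mpr fun hc => ?_
    rintro _ ⟨s, hs, rfl⟩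
    exact SysFun.doAssign_of_mem _ hc s (by simp)
  | cfCmp hγ _ _ ih₁ ih₂ =>
    refine sat_boxr.mpr fun hc => ?_
    have hm := hc.mono fun e he => Multiset.mem_add.mpr (Or.inl he)
    refine sat_congr_of_cfFree hγ ?_ (sat_boxr.mp (ih₂ hT) hm)
    refine Set.image_congr fun s hs => ?_
    exact (SysFun.doAssign_add_singleton _ hc
      (sat_boxr.mp (ih₁ hT) hm _ (Set.mem_image_of_mem _ hs))).symm
  | cfBotE hm _ ih =>
    exact sat_of_empty _ (Set.image_eq_empty.mp (sat_bot.mp (sat_boxr.mp (ih hT) hm)))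
  | botCf m hne => exact sat_boxr.mpr fun hc => absurd hc (Eqns.not_consistent_of_ne hne)
  | cfCtr _ ih => exact sat_boxr_congr (fun e => by simp) (ih hT)
  | cfWk _ ih => exact sat_boxr_congr (fun e => by simp) (ih hT)
  | cfSub _ _ ih₁ ih₂ =>
    refine sat_boxr.mpr fun hc => ih₂ ?_
    rintro χ rfl
    exact sat_boxr.mp (ih₁ hT) hc
  | cfAndI _ _ ih₁ ih₂ =>
    exact sat_boxr.mpr fun hc => ⟨sat_boxr.mp (ih₁ hT) hc, sat_boxr.mp (ih₂ hT) hc⟩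
  | @cfOrDst Γ φ ψ m _ ih =>
    by_cases hc : m.Consistent
    · obtain ⟨T₁, T₂, h₁, h₂, hu, hφ, hψ⟩ := sat_boxr.mp (ih hT) hc
      -- A subteam of the intervened team is pulled back to a subteam of `T`.
      have key : ∀ {S : CausalTeam σ}, S.IsSubteam (T.intervene m) →
          ((T.restrict (T.F.doAssign T.recursive m ⁻¹' S.team)).intervene m).IsSubteam S := by
        refine fun hS => ⟨?_, hS.2.symm⟩
        rintro _ ⟨s, hs, rfl⟩
        exact hs.2
      refine sat_or_of_subset _ _ (fun s hs => ?_)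
        (sat_boxr.mpr fun _ => hφ.mono (key h₁)) (sat_boxr.mpr fun _ => hψ.mono (key h₂))
      have : T.F.doAssign T.recursive m s ∈ T₁.team ∪ T₂.team :=
        hu ▸ Set.mem_image_of_mem _ hs
      exact this
    · exact sat_or_inl (sat_boxr.mpr fun h => absurd h hc)
  | @cfOrDstInv Γ φ ψ m _ ih =>
    obtain ⟨T₁, T₂, h₁, h₂, hu, hφ, hψ⟩ := ih hT
    refine sat_boxr.mpr fun hc => ⟨_, _, h₁.intervene m, h₂.intervene m, ?_,
      sat_boxr.mp hφ hc, sat_boxr.mp hψ hc⟩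
    obtain ⟨B, F, hF, hB⟩ := T
    obtain ⟨B₁, F₁, hF₁, hB₁⟩ := T₁
    obtain ⟨B₂, F₂, hF₂, hB₂⟩ := T₂
    obtain ⟨-, rfl⟩ := h₁
    obtain ⟨-, h⟩ := h₂
    simp only at h hu
    subst h hu
    exact (Set.image_union _ _ _).symm
  | @cfExtr Γ φ m n hm _ ih =>
    refine sat_boxr.mpr fun hc => ?_
    have hn : n.Consistent := hc.mono fun e he => Multiset.mem_add.mpr (Or.inr he)
    rw [← T.intervene_intervene hm hn]
    exact sat_boxr.mp (sat_boxr.mp (ih hT) hm) hn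
  | cfExp hd _ ih =>
    refine sat_boxr.mpr fun hm => sat_boxr.mpr fun hn => ?_
    rw [T.intervene_intervene hm hn, Eqns.minus_eq_self hd]
    exact sat_boxr.mp (ih hT) (hm.add hn hd)
  | @negCfE Γ m α _ ih =>
    refine sat_boxr.mpr fun hc => ?_
    rintro _ ⟨s, hs, rfl⟩ hα
    refine ih hT s hs (sat_boxr.mpr fun _ => ?_)
    rwa [CausalTeam.single_intervene hs]
  | @recur Γ k X hX _ ih =>
    intro s hs h
    have hp := CausalTeam.isPoint_single hs
    have hpath : ∀ i : Fin (k + 2), Relation.ReflTransGen T.F.Edge (X 0) (X i) := by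
      intro i
      induction i using Fin.induction with
      | zero => exact .refl
      | succ i ihi =>
        refine ihi.trans (Relation.TransGen.to_reflTransGen ?_)
        refine transGen_of_sat_affects (L := Lang.cov) (T := T.single s hs) ?_ hp
          ((ih i hT).mono (CausalTeam.single_isSubteam hs))
        exact fun h => (Fin.castSucc_lt_succ (i := i)).ne (hX h)
    have hlast := transGen_of_sat_affects ?_ hp h
    · exact T.recursive _ (Relation.TransGen.trans_left hlast (hpath _))
    · exact fun h => Fin.last_pos.ne' (hX h)
  | orCom _ ih => exact sat_or_comm (ih hT)
  | orAss _ ih =>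
    obtain ⟨T₁₂, T₃, h₁₂, h₃, hu, ⟨T₁, T₂, h₁, h₂, hu', hφ, hψ⟩, hχ⟩ := ih hT
    refine ⟨T₁, T.restrict (T₂.team ∪ T₃.team), h₁.trans h₁₂, T.restrict_isSubteam _, ?_, hφ,
      sat_or_of_subset T₂.team T₃.team Set.inter_subset_right (hψ.mono ?_) (hχ.mono ?_)⟩
    · rw [← hu, ← hu']
      simp only [CausalTeam.restrict, ← hu, ← hu']
      ext s
      simp only [Set.mem_union, Set.mem_inter_iff]
      tauto
    · exact ⟨Set.inter_subset_right, (h₂.trans h₁₂).2.symm⟩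
    · exact ⟨Set.inter_subset_right, h₃.2.symm⟩
  | orSub _ _ ih₁ ih₂ =>
    obtain ⟨T₁, T₂, h₁, h₂, hu, hφ, hψ⟩ := ih₁ hT
    exact ⟨T₁, T₂, h₁, h₂, hu, ih₂ (sat_insert hT h₁ hφ), hψ⟩
  | idisjI₁ _ ih => exact Or.inl (ih hT)
  | idisjI₂ _ ih => exact Or.inr (ih hT)
  | idisjE _ _ _ ih ih₁ ih₂ =>
    rcases ih hT with h | h
    · exact ih₁ (sat_insert hT (.refl T) h)
    · exact ih₂ (sat_insert hT (.refl T) h)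
  | orIdisjDst _ ih =>
    obtain ⟨T₁, T₂, h₁, h₂, hu, hφ, hψ | hχ⟩ := ih hT
    · exact Or.inl ⟨T₁, T₂, h₁, h₂, hu, hφ, hψ⟩
    · exact Or.inr ⟨T₁, T₂, h₁, h₂, hu, hφ, hχ⟩
  | @cfIdisjDst Γ ψ χ m _ ih =>
    by_cases hc : m.Consistent
    · exact (sat_boxr.mp (ih hT) hc).imp (fun h => sat_boxr.mpr fun _ => h)
        (fun h => sat_boxr.mpr fun _ => h)
    · exact Or.inl (sat_boxr.mpr fun h => absurd h hc)

/-! ### Derived rules -/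

open Form

namespace Derives

variable {A Γ Δ : Set (Form σ Lang.cov)} {φ ψ χ : Form σ Lang.cov} {m n : Eqns σ}

theorem mono (h : Derives A Γ φ) (hΓ : Γ ⊆ Δ) : Derives A Δ φ := by
  induction h generalizing Δ with
  | hyp h => exact hyp (hΓ h)
  | ax h => exact ax h
  | valDef X => exact valDef X
  | valUnq hne _ ih => exact valUnq hne (ih hΓ)
  | andI _ _ ih₁ ih₂ => exact andI (ih₁ hΓ) (ih₂ hΓ)
  | andE₁ _ ih => exact andE₁ (ih hΓ)
  | andE₂ _ ih => exact andE₂ (ih hΓ)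
  | orI₁ _ ih => exact orI₁ (ih hΓ)
  | orI₂ _ ih => exact orI₂ (ih hΓ)
  | orE _ _ _ ih ih₁ ih₂ =>
    exact orE (ih hΓ) (ih₁ (Set.insert_subset_insert hΓ)) (ih₂ (Set.insert_subset_insert hΓ))
  | negI _ ih => exact negI (ih (Set.insert_subset_insert hΓ))
  | negE _ _ ih₁ ih₂ => exact negE (ih₁ hΓ) (ih₂ hΓ)
  | raa _ ih => exact raa (ih (Set.insert_subset_insert hΓ))
  | cfEff m Y y => exact cfEff m Y y
  | cfCmp hγ _ _ ih₁ ih₂ => exact cfCmp hγ (ih₁ hΓ) (ih₂ hΓ)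
  | cfBotE hm _ ih => exact cfBotE hm (ih hΓ)
  | botCf m hne => exact botCf m hne
  | cfCtr _ ih => exact cfCtr (ih hΓ)
  | cfWk _ ih => exact cfWk (ih hΓ)
  | cfSub _ h ih₁ _ => exact cfSub (ih₁ hΓ) h
  | cfAndI _ _ ih₁ ih₂ => exact cfAndI (ih₁ hΓ) (ih₂ hΓ)
  | cfOrDst _ ih => exact cfOrDst (ih hΓ)
  | cfOrDstInv _ ih => exact cfOrDstInv (ih hΓ)
  | cfExtr hm _ ih => exact cfExtr hm (ih hΓ)
  | cfExp hd _ ih => exact cfExp hd (ih hΓ)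
  | negCfE _ ih => exact negCfE (ih hΓ)
  | recur hX _ ih => exact recur hX fun i => ih i hΓ
  | orCom _ ih => exact orCom (ih hΓ)
  | orAss _ ih => exact orAss (ih hΓ)
  | orSub _ _ ih₁ ih₂ => exact orSub (ih₁ hΓ) (ih₂ (Set.insert_subset_insert hΓ))
  | idisjI₁ _ ih => exact idisjI₁ (ih hΓ)
  | idisjI₂ _ ih => exact idisjI₂ (ih hΓ)
  | idisjE _ _ _ ih ih₁ ih₂ =>
    exact idisjE (ih hΓ) (ih₁ (Set.insert_subset_insert hΓ)) (ih₂ (Set.insert_subset_insert hΓ))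
  | orIdisjDst _ ih => exact orIdisjDst (ih hΓ)
  | cfIdisjDst _ ih => exact cfIdisjDst (ih hΓ)

/-- Cut, for arbitrary conclusions: eliminate `φ ⩔ φ`. -/
theorem cut (h : Derives A Γ φ) (h' : Derives A (insert φ Γ) ψ) : Derives A Γ ψ :=
  idisjE (idisjI₁ h) h' h'

theorem trans (h : Derives A Γ φ) (h' : Derives A {φ} ψ) : Derives A Γ ψ :=
  h.cut (h'.mono (Set.singleton_subset_iff.mpr (Set.mem_insert _ _)))

theorem botE (h : Derives A Γ bot) : Derives A Γ φ :=
  negE (α := eq (Classical.arbitrary _) (Classical.arbitrary _)) (andE₁ h) (andE₂ h)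

theorem head (φ : Form σ Lang.cov) (Γ : Set (Form σ Lang.cov)) : Derives A (insert φ Γ) φ :=
  hyp (Set.mem_insert _ _)

theorem self (φ : Form σ Lang.cov) : Derives A {φ} φ := hyp (Set.mem_singleton _)

theorem weaken (h : Derives A Γ φ) (ψ : Form σ Lang.cov) : Derives A (insert ψ Γ) φ :=
  h.mono (Set.subset_insert _ _)

/-- A counterfactual antecedent contributes only the set of its equations. -/
theorem boxr_congr (h : Derives A Γ (boxr m φ)) (hmn : ∀ e, e ∈ m ↔ e ∈ n) :
    Derives A Γ (boxr n φ) := by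
  have step : ∀ (e : Eqn σ) (k : Eqns σ), e ∈ k →
      (Derives A Γ (boxr (e ::ₘ k) φ) ↔ Derives A Γ (boxr k φ)) := by
    intro e k he
    obtain ⟨k, rfl⟩ := Multiset.exists_cons_of_mem he
    have h₁ : e ::ₘ e ::ₘ k = {e} + {e} + k := by
      rw [add_assoc, Multiset.singleton_add, Multiset.singleton_add]
    have h₂ : e ::ₘ k = {e} + k := (Multiset.singleton_add _ _).symm
    rw [h₁, h₂]
    exact ⟨cfCtr, cfWk⟩
  have absorb : ∀ j k : Eqns σ, (∀ e ∈ j, e ∈ k) →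
      (Derives A Γ (boxr (j + k) φ) ↔ Derives A Γ (boxr k φ)) := by
    intro j k
    induction j using Multiset.induction with
    | empty => simp
    | cons e j ih =>
      intro hj
      rw [Multiset.cons_add, step e (j + k)
        (Multiset.mem_add.mpr (Or.inr (hj e (Multiset.mem_cons_self _ _))))]
      exact ih fun e' he' => hj e' (Multiset.mem_cons_of_mem he')
  rw [← absorb n m fun e he => (hmn e).mpr he, add_comm,
    absorb m n fun e he => (hmn e).mp he] at h
  exact h

/-- A formula derivable without assumptions holds after every intervention. -/
theorem boxr_of_theorem (h : Derives A ∅ φ) (m : Eqns σ) : Derives A Γ (boxr m φ) := by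
  induction m using Multiset.induction with
  | empty =>
    rw [boxr, dif_pos rfl]
    exact h.mono (Set.empty_subset _)
  | cons e m _ =>
    have := cfEff (A := A) (Γ := Γ) m e.1 e.2
    rw [add_comm, Multiset.singleton_add] at this
    exact cfSub this (h.mono (Set.empty_subset _))

theorem boxr_of_not_consistent (h : ¬ m.Consistent) : Derives A Γ (boxr m φ) := by
  obtain ⟨X, x, x', n, hne, rfl⟩ := Eqns.exists_of_not_consistent h
  exact botCf n hne

theorem boxr_eq_of_mem {V : σ.Dom} {x : σ.Ran V} (h : (⟨V, x⟩ : Eqn σ) ∈ m) :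
    Derives A Γ (boxr m (eq V x)) := by
  obtain ⟨n, rfl⟩ := Multiset.exists_cons_of_mem h
  have := cfEff (A := A) (Γ := Γ) n V x
  rwa [add_comm, Multiset.singleton_add] at this

/-! ### Finite disjunctions and conjunctions -/

theorem listAnd_elim {l : List (Form σ Lang.cov)} (h : Derives A Γ (listAnd l)) (hφ : φ ∈ l) :
    Derives A Γ φ := by
  match l with
  | [ψ] => rwa [List.mem_singleton.mp hφ]
  | ψ :: χ :: l =>
    rcases List.mem_cons.mp hφ with rfl | hφ
    · exact andE₁ h
    · exact listAnd_elim (andE₂ h) hφ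

theorem bigAnd_elim {ι : Type*} [Finite ι] {φ : ι → Form σ Lang.cov}
    (h : Derives A Γ (bigAnd φ)) (i : ι) : Derives A Γ (φ i) :=
  listAnd_elim h (List.mem_map.mpr ⟨i, mem_enum i, rfl⟩)

theorem listOr_intro {l : List (Form σ Lang.cov)} (hφ : φ ∈ l) (h : Derives A Γ φ) :
    Derives A Γ (listOr l) := by
  match l with
  | [ψ] => rwa [List.mem_singleton.mp hφ] at h
  | ψ :: χ :: l =>
    rcases List.mem_cons.mp hφ with rfl | hφ
    · exact orI₁ h
    · exact orI₂ (listOr_intro hφ h)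

theorem bigOr_intro {ι : Type*} [Finite ι] {φ : ι → Form σ Lang.cov} (i : ι)
    (h : Derives A Γ (φ i)) : Derives A Γ (bigOr φ) :=
  listOr_intro (List.mem_map.mpr ⟨i, mem_enum i, rfl⟩) h

theorem boxr_listOr_elim {Γ : Set (Form σ Lang.cov)} {l : List (Form σ Lang.cov)}
    (hl : l ≠ []) {α : Form σ Lang.co}
    (h : Derives A Γ (boxr m (listOr l)))
    (hα : ∀ φ ∈ l, Derives A (insert (boxr m φ) Γ) α.lift) : Derives A Γ α.lift := by
  match l with
  | [φ] => exact h.cut (hα φ (List.mem_singleton_self φ))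
  | φ :: ψ :: l =>
    refine orE (cfOrDst h) (hα φ (by simp)) ?_
    refine boxr_listOr_elim (l := ψ :: l) (by simp) (head _ _) fun χ hχ => ?_
    exact (hα χ (List.mem_cons_of_mem _ hχ)).mono
      (Set.insert_subset_insert (Set.subset_insert _ _))

/-- Case distinction, for a conclusion of the basic language, on the value that `V` takes after
the intervention `m`. -/
theorem cases_value (m : Eqns σ) (V : σ.Dom) {α : Form σ Lang.co}
    (h : ∀ x, Derives A (insert (boxr m (eq V x)) Γ) α.lift) : Derives A Γ α.lift := by
  refine boxr_listOr_elim (m := m) ?_ (boxr_of_theorem (valDef V) m) fun φ hφ => ?_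
  · have : Classical.arbitrary (σ.Ran V) ∈ enum (σ.Ran V) := mem_enum _
    rw [Ne, List.map_eq_nil_iff]
    exact List.ne_nil_of_mem this
  · obtain ⟨x, -, rfl⟩ := List.mem_map.mp hφ
    exact h x

theorem listIdisj_intro {l : List (Form σ Lang.cov)} (hφ : φ ∈ l) (h : Derives A Γ φ) :
    Derives A Γ (listIdisj l) := by
  match l with
  | [ψ] => rwa [List.mem_singleton.mp hφ] at h
  | ψ :: χ :: l =>
    rcases List.mem_cons.mp hφ with rfl | hφ
    · exact idisjI₁ h
    · exact idisjI₂ (listIdisj_intro hφ h)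

theorem listIdisj_elim {Γ : Set (Form σ Lang.cov)} {l : List (Form σ Lang.cov)}
    (h : Derives A Γ (listIdisj l))
    (hχ : ∀ φ ∈ l, Derives A (insert φ Γ) χ) : Derives A Γ χ := by
  match l with
  | [] => exact botE h
  | [φ] => exact h.cut (hχ φ (List.mem_singleton_self φ))
  | φ :: ψ :: l =>
    refine idisjE h (hχ φ (by simp)) ?_
    refine listIdisj_elim (l := ψ :: l) (head _ _) fun θ hθ => ?_
    exact (hχ θ (List.mem_cons_of_mem _ hθ)).mono
      (Set.insert_subset_insert (Set.subset_insert _ _))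

theorem or_listIdisj {Γ : Set (Form σ Lang.cov)} {l : List (Form σ Lang.cov)} (hl : l ≠ [])
    (h : Derives A Γ (or φ (listIdisj l))) : Derives A Γ (listIdisj (l.map (or φ))) := by
  match l with
  | [ψ] => exact h
  | ψ :: χ :: l =>
    exact idisjE (orIdisjDst h) (idisjI₁ (head _ _))
      (idisjI₂ (or_listIdisj (l := χ :: l) (by simp) (head _ _)))

theorem boxr_listIdisj {Γ : Set (Form σ Lang.cov)} {l : List (Form σ Lang.cov)} (hl : l ≠ [])
    (h : Derives A Γ (boxr m (listIdisj l))) : Derives A Γ (listIdisj (l.map (boxr m))) := by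
  match l with
  | [ψ] => exact h
  | ψ :: χ :: l =>
    exact idisjE (cfIdisjDst h) (idisjI₁ (head _ _))
      (idisjI₂ (boxr_listIdisj (l := χ :: l) (by simp) (head _ _)))

/-! ### Negation and counterfactuals in the basic language -/

theorem notI_not {α : Form σ Lang.co} (h : Derives A Γ α.lift) : Derives A Γ (neg (neg α)) :=
  negI (negE (h.weaken _) (head _ _))

theorem notNot_elim {α : Form σ Lang.co} (h : Derives A Γ (neg (neg α))) :
    Derives A Γ α.lift :=
  raa (negE (α := neg α) (head _ _) (h.weaken _))

theorem boxr_absurd {α : Form σ Lang.co} (hm : m.Consistent) (h : Derives A Γ (boxr m α.lift))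
    (h' : Derives A Γ (boxr m (neg α))) : Derives A Γ φ :=
  cfBotE hm (cfSub (cfAndI h h') (negE (andE₁ (self _)) (andE₂ (self _))))

/-- The converse of the rule `cfExtr`, for consequents of the basic language: it also covers
equations of `m` that are overwritten by `n`. -/
theorem boxr_boxr {α : Form σ Lang.co} (hm : m.Consistent) (hn : n.Consistent)
    (h : Derives A Γ (boxr (m.minus n + n) α.lift)) :
    Derives A Γ (boxr m (boxr n α.lift)) := by
  have : Derives A Γ (boxr m (boxr n α)).lift := by
    refine raa (boxr_absurd (hm.minus_add hn) (h.weaken _) (cfExtr hm ?_))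
    exact cfSub (negCfE (head _ _)) (negCfE (self _))
  rwa [lift_boxr, lift_boxr] at this

/-- After a consistent intervention, the negation of a counterfactual follows from the
counterfactual with the negated consequent. -/
theorem boxr_neg_boxr {α : Form σ Lang.co} (hm : m.Consistent) (hn : n.Consistent)
    (h : Derives A Γ (boxr (m.minus n + n) (neg α))) :
    Derives A Γ (boxr m (neg (boxr n α))) := by
  have : Derives A Γ (boxr m (neg (boxr n α)) : Form σ Lang.co).lift := by
    refine raa (boxr_absurd (hm.minus_add hn) (cfExtr hm ?_) (h.weaken _))
    rw [← lift_boxr]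
    exact cfSub (negCfE (head _ _)) (notNot_elim (self _))
  rwa [lift_boxr] at this

end Derives

/-! ### Normal forms -/

namespace Derives

variable {A Γ : Set (Form σ Lang.cov)} {φ ψ : Form σ Lang.cov}

theorem or_map (h : Derives A Γ (or φ ψ)) {φ' ψ' : Form σ Lang.cov} (h₁ : Derives A {φ} φ')
    (h₂ : Derives A {ψ} ψ') : Derives A Γ (or φ' ψ') :=
  orCom (orSub (orCom (orSub h ((head _ _).trans h₁))) ((head _ _).trans h₂))

/-- Every formula is provably equivalent to an intuitionistic disjunction of formulas of the basic
language. -/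
theorem exists_normalForm (A : Set (Form σ Lang.cov)) : {L : Lang} → (φ : Form σ L) →
    ∃ l : List (Form σ Lang.co), l ≠ [] ∧ (∀ α ∈ l, Derives A {α.lift} φ.lift) ∧
      Derives A {φ.lift} (listIdisj (l.map lift))
  | _, eq X x => ⟨[eq X x], by simp,
      fun α hα => by rw [List.mem_singleton.mp hα]; exact self _, self _⟩
  | _, neg α => ⟨[neg α], by simp,
      fun β hβ => by rw [List.mem_singleton.mp hβ]; exact self _, self _⟩
  | _, .and φ ψ => by
    obtain ⟨l, hl, hl₁, hl₂⟩ := exists_normalForm A φ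
    obtain ⟨k, hk, hk₁, hk₂⟩ := exists_normalForm A ψ
    refine ⟨(l ×ˢ k).map fun p => and p.1 p.2, ?_, ?_, ?_⟩
    · obtain ⟨a, ha⟩ := List.exists_mem_of_ne_nil l hl
      obtain ⟨b, hb⟩ := List.exists_mem_of_ne_nil k hk
      exact List.ne_nil_of_mem (List.mem_map.mpr ⟨(a, b), List.mem_product.mpr ⟨ha, hb⟩, rfl⟩)
    · intro γ hγ
      obtain ⟨⟨α, β⟩, hp, rfl⟩ := List.mem_map.mp hγ
      obtain ⟨hα, hβ⟩ := List.mem_product.mp hp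
      exact andI ((andE₁ (self (and α.lift β.lift))).trans (hl₁ α hα))
        ((andE₂ (self (and α.lift β.lift))).trans (hk₁ β hβ))
    · refine listIdisj_elim ((andE₁ (self (and φ.lift ψ.lift))).trans hl₂) fun a ha => ?_
      refine listIdisj_elim
        ((andE₂ ((self (and φ.lift ψ.lift)).weaken _)).trans hk₂) fun b hb => ?_
      obtain ⟨α, hα, rfl⟩ := List.mem_map.mp ha
      obtain ⟨β, hβ, rfl⟩ := List.mem_map.mp hb
      refine listIdisj_intro (φ := and α.lift β.lift) (List.mem_map.mpr ⟨and α β, ?_, rfl⟩)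
        (andI ((head _ _).weaken _) (head _ _))
      exact List.mem_map.mpr ⟨(α, β), List.mem_product.mpr ⟨hα, hβ⟩, rfl⟩
  | _, .or φ ψ => by
    obtain ⟨l, hl, hl₁, hl₂⟩ := exists_normalForm A φ
    obtain ⟨k, hk, hk₁, hk₂⟩ := exists_normalForm A ψ
    refine ⟨(l ×ˢ k).map fun p => or p.1 p.2, ?_, ?_, ?_⟩
    · obtain ⟨a, ha⟩ := List.exists_mem_of_ne_nil l hl
      obtain ⟨b, hb⟩ := List.exists_mem_of_ne_nil k hk
      exact List.ne_nil_of_mem (List.mem_map.mpr ⟨(a, b), List.mem_product.mpr ⟨ha, hb⟩, rfl⟩)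
    · intro γ hγ
      obtain ⟨⟨α, β⟩, hp, rfl⟩ := List.mem_map.mp hγ
      obtain ⟨hα, hβ⟩ := List.mem_product.mp hp
      exact or_map (self (or α.lift β.lift)) (hl₁ α hα) (hk₁ β hβ)
    · have h := or_map (self (A := A) (or φ.lift ψ.lift)) hl₂ hk₂
      refine listIdisj_elim (or_listIdisj (by simpa using hk) h) fun b hb => ?_
      obtain ⟨b', hb', rfl⟩ := List.mem_map.mp hb
      obtain ⟨β, hβ, rfl⟩ := List.mem_map.mp hb'
      refine listIdisj_elim (or_listIdisj (by simpa using hl) (orCom (head _ _))) fun a ha => ?_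
      obtain ⟨a', ha', rfl⟩ := List.mem_map.mp ha
      obtain ⟨α, hα, rfl⟩ := List.mem_map.mp ha'
      refine listIdisj_intro (φ := or α.lift β.lift) (List.mem_map.mpr ⟨or α β, ?_, rfl⟩)
        (orCom (head _ _))
      exact List.mem_map.mpr ⟨(α, β), List.mem_product.mpr ⟨hα, hβ⟩, rfl⟩
  | _, idisj φ ψ => by
    obtain ⟨l, hl, hl₁, hl₂⟩ := exists_normalForm A φ
    obtain ⟨k, hk, hk₁, hk₂⟩ := exists_normalForm A ψ
    rw [lift_cov] at hl₂ hk₂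
    refine ⟨l ++ k, by simp [hl], ?_, ?_⟩
    · intro α hα
      rcases List.mem_append.mp hα with hα | hα
      · exact idisjI₁ (lift_cov φ ▸ hl₁ α hα)
      · exact idisjI₂ (lift_cov ψ ▸ hk₁ α hα)
    · refine idisjE (self (idisj φ ψ)) ?_ ?_
      · refine listIdisj_elim ((head _ _).trans hl₂) fun a ha => ?_
        exact listIdisj_intro (by rw [List.map_append]; exact List.mem_append_left _ ha) (head _ _)
      · refine listIdisj_elim ((head _ _).trans hk₂) fun a ha => ?_
        exact listIdisj_intro (by rw [List.map_append]; exact List.mem_append_right _ ha)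
          (head _ _)
  | _, cf m hm φ => by
    obtain ⟨l, hl, hl₁, hl₂⟩ := exists_normalForm A φ
    have hbox : ∀ {L : Lang} (χ : Form σ L), cf m hm χ = boxr m χ := fun χ => by
      rw [boxr, dif_neg hm]
    refine ⟨l.map (boxr m), by simpa using hl, ?_, ?_⟩
    · intro γ hγ
      obtain ⟨α, hα, rfl⟩ := List.mem_map.mp hγ
      rw [hbox, lift_boxr, lift_boxr]
      exact cfSub (self _) (hl₁ α hα)
    · rw [hbox, lift_boxr]
      have := boxr_listIdisj (by simpa using hl) (cfSub (self (A := A) (boxr m φ.lift)) hl₂)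
      simpa only [List.map_map, Function.comp_def, lift_boxr] using this

end Derives

/-! ### Reduced systems of functions -/

namespace Law

variable {V : σ.Dom}

/-- The value of a law as a function of a whole assignment. -/
def total (f : Law σ V) (s : Assignment σ) : σ.Ran V := f.fn (fun X => s X)

/-- The value of the law depends on the variable `X`. -/
def Relevant (f : Law σ V) (X : σ.Dom) : Prop :=
  ∃ s s' : Assignment σ, (∀ Y ≠ X, s Y = s' Y) ∧ f.total s ≠ f.total s'

theorem Relevant.mem_parents {f : Law σ V} {X : σ.Dom} (h : f.Relevant X) : X ∈ f.parents := by
  obtain ⟨s, s', hs, hne⟩ := h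
  by_contra hX
  refine hne (congrArg f.fn ?_)
  funext Y
  exact hs Y fun hY => hX (hY ▸ Y.2)

/-- Changing the irrelevant variables, one at a time, does not change the value of a law. -/
theorem total_congr {f : Law σ V} {s s' : Assignment σ}
    (h : ∀ X, f.Relevant X → s X = s' X) : f.total s = f.total s' := by
  classical
  let _ := Fintype.ofFinite σ.Dom
  have key : ∀ (D : Finset σ.Dom) (s : Assignment σ), (∀ X ∉ D, s X = s' X) →
      (∀ X, f.Relevant X → s X = s' X) → f.total s = f.total s' := by
    intro D
    induction D using Finset.induction with
    | empty =>
      intro s hD _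
      rw [funext fun X => hD X (Finset.notMem_empty X)]
    | insert X D _ ih =>
      intro s hD hs
      have h₁ : f.total s = f.total (Function.update s X (s' X)) := by
        by_contra hne
        have hX : f.Relevant X :=
          ⟨_, _, fun Y hY => (Function.update_of_ne hY _ _).symm, hne⟩
        rw [← hs X hX, Function.update_eq_self] at hne
        exact hne rfl
      rw [h₁]
      refine ih _ (fun Y hY => ?_) (fun Y hY => ?_) <;> by_cases hYX : Y = X
      · subst hYX
        rw [Function.update_self]
      · rw [Function.update_of_ne hYX]
        exact hD Y (by simp [hY, hYX])
      · subst hYX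
        rw [Function.update_self]
      · rw [Function.update_of_ne hYX]
        exact hs Y hY
  exact key Finset.univ s (fun X hX => absurd (Finset.mem_univ X) hX) h

open Classical in
/-- The law with the same values in which only the relevant variables are kept as parents. -/
noncomputable def reduce (f : Law σ V) : Law σ V where
  parents := f.parents.filter f.Relevant
  not_mem h := f.not_mem (Finset.mem_filter.mp h).1
  fn p := f.total fun X =>
    if h : X ∈ f.parents.filter f.Relevant then p ⟨X, h⟩ else Classical.arbitrary _

theorem mem_reduce_parents {f : Law σ V} {X : σ.Dom} :
    X ∈ f.reduce.parents ↔ f.Relevant X := by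
  classical
  unfold reduce
  rw [Finset.mem_filter]
  exact ⟨And.right, fun h => ⟨h.mem_parents, h⟩⟩

theorem reduce_fn (f : Law σ V) (s : Assignment σ) :
    f.reduce.fn (fun X => s X) = f.total s := by
  classical
  have : f.reduce.fn (fun X => s X) = f.total fun X =>
      if X ∈ f.parents.filter f.Relevant then s X else Classical.arbitrary _ := rfl
  rw [this]
  refine total_congr fun X hX => ?_
  exact if_pos (Finset.mem_filter.mpr ⟨hX.mem_parents, hX⟩)

end Law

/-- The system of functions in which every law is reduced to its relevant parents. -/
noncomputable def SysFun.reduce (F : SysFun σ) : SysFun σ := fun V => (F V).map Law.reduce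

theorem SysFun.exists_of_reduce {F : SysFun σ} {V : σ.Dom} {g : Law σ V}
    (h : F.reduce V = some g) : ∃ f, F V = some f ∧ f.reduce = g :=
  Option.map_eq_some_iff.mp h

/-! ### Consequences of the formula describing a system of functions -/

/-- The equations in `m` are those of the assignment `s` on all variables other than `V`. -/
def Eqns.IsSetting (m : Eqns σ) (s : Assignment σ) (V : σ.Dom) : Prop :=
  ∀ e : Eqn σ, e ∈ m ↔ e.1 ≠ V ∧ s e.1 = e.2

theorem Eqns.IsSetting.consistent {m : Eqns σ} {s : Assignment σ} {V : σ.Dom}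
    (h : m.IsSetting s V) : m.Consistent := fun _ _ _ hx hx' =>
  ((h _).mp hx).2.symm.trans ((h _).mp hx').2

theorem Eqns.exists_isSetting (s : Assignment σ) (V : σ.Dom) :
    ∃ m : Eqns σ, m.IsSetting s V := by
  classical
  let _ := Fintype.ofFinite σ.Dom
  refine ⟨Eqns.ofTuple (Finset.univ \ {V}) (fun X => s X), fun e => ?_⟩
  rw [Eqns.mem_ofTuple_restrict]
  simp

namespace Derives

variable {A Γ : Set (Form σ Lang.cov)} {φ : Form σ Lang.cov} {m n : Eqns σ} {F : SysFun σ}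
  {V : σ.Dom} {s : Assignment σ}

theorem eta_elim {f : Law σ V} (h : Derives A Γ (eta f)) (hm : m.IsSetting s V) :
    Derives A Γ (boxr m (eq V (f.total s))) := by
  classical
  let _ := Fintype.ofFinite σ.Dom
  refine (bigAnd_elim h (fun X => s X, fun X => s X)).boxr_congr fun e => ?_
  rw [Multiset.mem_add, Eqns.mem_ofTuple_restrict, Eqns.mem_ofTuple_restrict, hm e]
  by_cases he : e.1 ∈ f.parents
  · have : e.1 ≠ V := fun h => f.not_mem (h ▸ he)
    simp [he, this]
  · simp [he]

theorem xi_elim (h : Derives A Γ (xi V)) {v : σ.Ran V} (hv : Derives A Γ (eq V v))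
    (hm : m.IsSetting s V) : Derives A Γ (boxr m (eq V v)) := by
  classical
  let _ := Fintype.ofFinite σ.Dom
  have h' := bigAnd_elim h (v, fun X => s X)
  have : Derives A Γ (boxr m (eq V v : Form σ Lang.co)).lift := by
    refine orE h' (negE (α := eq V v) (hv.weaken _) (head _ _)) ?_
    rw [lift_boxr]
    refine (head _ _).boxr_congr fun e => ?_
    rw [Eqns.mem_ofTuple_restrict, hm e]
    simp
  rwa [lift_boxr] at this

theorem eta_of_Phi (h : Derives A Γ (Phi F)) {f : Law σ V} (hf : F V = some f) :
    Derives A Γ (eta f) := by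
  have hV : V ∈ F.En := ⟨f, hf⟩
  have := bigAnd_elim (andE₁ h) ⟨V, hV⟩
  rwa [SysFun.choose_eq hV hf] at this

theorem xi_of_Phi (h : Derives A Γ (Phi F)) (hV : F V = none) : Derives A Γ (xi V) := by
  refine bigAnd_elim (andE₂ h) ⟨V, Or.inl ?_⟩
  rintro ⟨f, hf⟩
  rw [hV] at hf
  cases hf

/-- A relevant parent provably affects its child. -/
theorem affects_of_Phi (h : Derives A Γ (Phi F)) {X : σ.Dom} (hX : F.reduce.Edge X V) :
    Derives A Γ (affects X V) := by
  classical
  let _ := Fintype.ofFinite σ.Dom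
  obtain ⟨g, hg, hXg⟩ := hX
  obtain ⟨f, hf, rfl⟩ := SysFun.exists_of_reduce hg
  rw [Law.mem_reduce_parents] at hXg
  have hXV : X ≠ V := fun h => f.not_mem (h ▸ hXg.mem_parents)
  obtain ⟨s, s', hs, hne⟩ := hXg
  have hsX : s X ≠ s' X := by
    intro h
    refine hne (congrArg f.total (funext fun Y => ?_))
    by_cases hY : Y = X
    · subst hY; exact h
    · exact hs Y hY
  have key : ∀ r : Assignment σ, (∀ Y ≠ X, s Y = r Y) →
      Derives A Γ (boxr (Eqns.ofTuple (Finset.univ \ {X, V}) (fun Y => s Y))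
        (boxr {⟨X, r X⟩} (eq V (f.total r)))) := by
    intro r hr
    obtain ⟨m, hm⟩ := Eqns.exists_isSetting r V
    refine cfExp ?_ (((h.eta_of_Phi hf).eta_elim hm).boxr_congr fun e => ?_)
    · rw [Eqns.vars_ofTuple, Set.disjoint_left]
      rintro Y hY ⟨y, hy⟩
      have := (Sigma.mk.inj_iff.mp (Multiset.mem_singleton.mp hy)).1
      simp [this] at hY
    · obtain ⟨Y, y⟩ := e
      rw [hm, Multiset.mem_add, Eqns.mem_ofTuple_restrict, Multiset.mem_singleton]
      by_cases hY : Y = X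
      · subst hY
        simp [hXV, eq_comm]
      · simp [hY, hr Y hY]
  refine bigOr_intro ⟨((⟨Finset.univ \ {X, V}, fun Y => s Y⟩, (s X, s' X),
    (f.total s, f.total s'))), by simp, by simp, hsX, hne⟩ ?_
  exact cfAndI (key s fun _ _ => rfl) (key s' hs)

end Derives

/-- A relation with a directed cycle but no loop has a cycle without repetitions. -/
theorem exists_injective_cycle {α : Type*} {r : α → α → Prop} (hr : ∀ x, ¬ r x x) {a : α}
    (h : Relation.TransGen r a a) : ∃ (k : ℕ) (X : Fin (k + 2) → α), Function.Injective X ∧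
      (∀ i : Fin (k + 1), r (X i.castSucc) (X i.succ)) ∧ r (X (Fin.last (k + 1))) (X 0) := by
  classical
  have path : ∀ b, Relation.TransGen r a b → ∃ (n : ℕ) (c : ℕ → α), c 0 = a ∧ c (n + 1) = b ∧
      ∀ i ≤ n, r (c i) (c (i + 1)) := by
    intro b hb
    induction hb with
    | @single b hb =>
      refine ⟨0, fun i => if i = 0 then a else b, rfl, rfl, fun i hi => ?_⟩
      obtain rfl : i = 0 := by omega
      exact hb
    | @tail b d _ hbd ih =>
      obtain ⟨n, c, h0, hn, hc⟩ := ih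
      refine ⟨n + 1, fun i => if i ≤ n + 1 then c i else d, by simp [h0], by simp,
        fun i hi => ?_⟩
      by_cases hi' : i ≤ n
      · simpa [hi, Nat.succ_le_succ hi'] using hc i hi'
      · obtain rfl : i = n + 1 := by omega
        simpa [hn] using hbd
  have hex : ∃ n, ∃ c : ℕ → α, c (n + 1) = c 0 ∧ ∀ i ≤ n, r (c i) (c (i + 1)) := by
    obtain ⟨n, c, h0, hn, hc⟩ := path a h
    exact ⟨n, c, hn.trans h0.symm, hc⟩
  obtain ⟨c, hc, hstep⟩ := Nat.find_spec hex
  have hmin := fun n hn => Nat.find_min hex (m := n) hn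
  generalize Nat.find hex = n at hc hstep hmin
  -- a repetition would cut off a shorter cycle
  have hinj : ∀ i j, i < j → j ≤ n → c i ≠ c j := by
    intro i j hij hj heq
    obtain ⟨d, rfl⟩ : ∃ d, j = i + (d + 1) := ⟨j - i - 1, by omega⟩
    exact hmin d (by omega) ⟨fun l => c (i + l), heq.symm,
      fun l hl => hstep (i + l) (by omega)⟩
  obtain ⟨k, rfl⟩ : ∃ k, n = k + 1 := by
    refine ⟨n - 1, ?_⟩
    rcases Nat.eq_zero_or_pos n with rfl | h
    · have := hstep 0 le_rfl
      rw [hc] at this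
      exact absurd this (hr _)
    · omega
  refine ⟨k, fun i => c i, ?_, ?_, ?_⟩
  · intro i j hij
    by_contra hne
    rcases lt_or_gt_of_ne hne with h | h
    · exact hinj i j h (by omega) hij
    · exact hinj j i h (by omega) hij.symm
  · intro i
    exact hstep i (by omega)
  · have := hstep (k + 1) le_rfl
    rw [hc] at this
    exact this

/-- The formula `Φ^F` is refutable unless `F` is recursive after removal of irrelevant parents. -/
theorem Derives.bot_of_not_recursive {A Γ : Set (Form σ Lang.cov)} {F : SysFun σ}
    (h : Derives A Γ (Phi F)) (hF : ¬ F.reduce.Recursive) : Derives A Γ bot := by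
  unfold SysFun.Recursive at hF
  push Not at hF
  obtain ⟨V, hV⟩ := hF
  obtain ⟨k, X, hX, hstep, hlast⟩ := exists_injective_cycle
    (fun V ⟨f, _, hVf⟩ => f.not_mem hVf) hV
  have hneg := recur hX fun i => h.affects_of_Phi (hstep i)
  refine negE (α := affects _ _) ?_ hneg
  rw [lift_affects]
  exact h.affects_of_Phi hlast

/-! ### Completeness -/

namespace Derives

variable {A Γ Δ : Set (Form σ Lang.cov)} {F : SysFun σ}

/-- To derive a formula of the basic language it suffices to derive it from all consistent
extensions of the assumptions that decide the value of each variable after each intervention. -/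
theorem of_forall_table {α : Form σ Lang.co}
    (h : ∀ Δ, Γ ⊆ Δ → ¬ Derives A Δ bot → (∀ m V, ∃ v, Derives A Δ (boxr m (eq V v))) →
      Derives A Δ α.lift) : Derives A Γ α.lift := by
  classical
  have key : ∀ (l : List (Finset (Eqn σ) × σ.Dom)) (Γ : Set (Form σ Lang.cov)),
      (∀ Δ, Γ ⊆ Δ → (∀ p ∈ l, ∃ v, Derives A Δ (boxr p.1.val (eq p.2 v))) →
        Derives A Δ α.lift) → Derives A Γ α.lift := by
    intro l
    induction l with
    | nil => exact fun Γ hΓ => hΓ Γ subset_rfl (by simp)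
    | cons p l ih =>
      refine fun Γ hΓ => cases_value p.1.val p.2 fun v => ih _ fun Δ hΔ hl => ?_
      refine hΓ Δ ((Set.subset_insert _ _).trans hΔ) fun q hq => ?_
      rcases List.mem_cons.mp hq with rfl | hq
      · exact ⟨v, hyp (hΔ (Set.mem_insert _ _))⟩
      · exact hl q hq
  refine key (enum _) Γ fun Δ hΔ ht => ?_
  by_cases hbot : Derives A Δ bot
  · exact hbot.botE
  · refine h Δ hΔ hbot fun m V => ?_
    obtain ⟨v, hv⟩ := ht (m.toFinset, V) (mem_enum _)
    exact ⟨v, hv.boxr_congr fun e => by rw [Finset.mem_val, Multiset.mem_toFinset]⟩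

theorem boxr_eq_unique (hΔ : ¬ Derives A Δ bot) {m : Eqns σ} (hm : m.Consistent) {V : σ.Dom}
    {x y : σ.Ran V} (hx : Derives A Δ (boxr m (eq V x))) (hy : Derives A Δ (boxr m (eq V y))) :
    x = y := by
  by_contra hne
  exact hΔ (boxr_absurd (α := eq V y) hm hy (cfSub hx (valUnq hne (self _))))

/-- Interventions that set variables to values they take anyway may be added to an antecedent. -/
theorem boxr_add {t : Assignment σ} {m : Eqns σ}
    (ht : ∀ V, Derives A Δ (boxr m (eq V (t V)))) {k : Eqns σ} (hk : ∀ e ∈ k, t e.1 = e.2)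
    {γ : Form σ Lang.cov} (hγ : γ.CfFree) (h : Derives A Δ (boxr m γ)) :
    Derives A Δ (boxr (m + k) γ) := by
  induction k using Multiset.induction generalizing γ with
  | empty => rwa [add_zero]
  | cons e k ih =>
    have hk' : ∀ e' ∈ k, t e'.1 = e'.2 := fun e' he' => hk e' (Multiset.mem_cons_of_mem he')
    have he : Derives A Δ (boxr m (eq e.1 e.2)) := by
      rw [← hk e (Multiset.mem_cons_self _ _)]
      exact ht e.1
    have := cfCmp hγ (ih hk' (γ := eq e.1 e.2) trivial he) (ih hk' hγ h)
    rwa [add_assoc, add_comm k, Multiset.singleton_add] at this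

section Table

variable {t : Eqns σ → Assignment σ} (hΔ : ¬ Derives A Δ bot)
  (ht : ∀ m V, Derives A Δ (boxr m (eq V (t m V)))) {m : Eqns σ} (hm : m.Consistent) {V : σ.Dom}

include hΔ ht hm

theorem table_mem {x : σ.Ran V} (h : (⟨V, x⟩ : Eqn σ) ∈ m) : t m V = x :=
  boxr_eq_unique hΔ hm (ht m V) (boxr_eq_of_mem h)

/-- The value of `V ∉ m` after `m` is also its value after fixing all the other variables to
their values after `m`. -/
theorem boxr_setting (hV : V ∉ m.vars) {k : Eqns σ} (hk : k.IsSetting (t m) V) :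
    Derives A Δ (boxr k (eq V (t m V))) := by
  refine (boxr_add (ht m) (k := k) (fun e he => ((hk e).mp he).2)
    (γ := eq V (t m V)) trivial (ht m V)).boxr_congr fun e => ?_
  rw [Multiset.mem_add, or_iff_right_iff_imp, hk]
  exact fun he => ⟨fun h => hV (h ▸ ⟨e.2, he⟩), table_mem hΔ ht hm he⟩

theorem table_exogenous (hF : Derives A Δ (Phi F)) (hV : V ∉ m.vars) (hf : F V = none) :
    t m V = t 0 V := by
  obtain ⟨k, hk⟩ := Eqns.exists_isSetting (t m) V
  have h₀ := ht 0 V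
  rw [boxr, dif_pos rfl] at h₀
  exact boxr_eq_unique hΔ hk.consistent (boxr_setting hΔ ht hm hV hk)
    ((hF.xi_of_Phi hf).xi_elim h₀ hk)

theorem table_endogenous (hF : Derives A Δ (Phi F)) (hV : V ∉ m.vars) {g : Law σ V}
    (hg : F.reduce V = some g) : t m V = g.fn (fun X => t m X) := by
  obtain ⟨f, hf, rfl⟩ := SysFun.exists_of_reduce hg
  obtain ⟨k, hk⟩ := Eqns.exists_isSetting (t m) V
  rw [Law.reduce_fn]
  exact boxr_eq_unique hΔ hk.consistent (boxr_setting hΔ ht hm hV hk)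
    ((hF.eta_of_Phi hf).eta_elim hk)

/-- The table of values is the one computed by the reduced system of functions. -/
theorem table_eq_doAssign (hF : Derives A Δ (Phi F)) (hrec : F.reduce.Recursive) :
    t m = F.reduce.doAssign hrec m (t 0) :=
  SysFun.eq_doAssign hrec hm (fun _ _ h => table_mem hΔ ht hm h)
    (fun _ hV hf => table_exogenous hΔ ht hm hF hV (Option.map_eq_none_iff.mp hf))
    (fun _ hV _ hg => table_endogenous hΔ ht hm hF hV hg)

end Table

/-- Truth lemma: if the values of all variables after all interventions on the one-point team `T`
are derivable, then so is, after each intervention, each formula of the basic language or its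
negation, according to its truth in `T`. -/
theorem truth {t : Eqns σ → Assignment σ} (ht : ∀ m V, Derives A Δ (boxr m (eq V (t m V))))
    {T : CausalTeam σ} (hT : ∀ m : Eqns σ, m.Consistent → (T.intervene m).team = {t m}) :
    (α : Form σ Lang.co) → {m : Eqns σ} → m.Consistent →
      (α.Sat (T.intervene m) → Derives A Δ (boxr m α.lift)) ∧
      (¬ α.Sat (T.intervene m) → Derives A Δ (boxr m (neg α)))
  | .eq X x, m, hm => by
    have hsat : (eq X x : Form σ Lang.co).Sat (T.intervene m) ↔ t m X = x := by
      simp only [Sat, hT m hm, Set.mem_singleton_iff, forall_eq]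
    rw [hsat]
    refine ⟨fun h => h ▸ ht m X, fun h => cfSub (ht m X) (valUnq h (self _))⟩
  | .neg α, m, hm => by
    have ih := truth ht hT α hm
    rw [sat_neg_iff ⟨_, hT m hm⟩, not_not]
    exact ⟨ih.2, fun h => cfSub (ih.1 h) (notI_not (self _))⟩
  | .and α β, m, hm => by
    have ihα := truth ht hT α hm
    have ihβ := truth ht hT β hm
    refine ⟨fun h => cfAndI (ihα.1 h.1) (ihβ.1 h.2), fun h => ?_⟩
    rcases not_and_or.mp h with h | h
    · exact cfSub (ihα.2 h)
        (negI (negE (andE₁ (head (and α.lift β.lift) _)) ((self (neg α)).weaken _)))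
    · exact cfSub (ihβ.2 h)
        (negI (negE (andE₂ (head (and α.lift β.lift) _)) ((self (neg β)).weaken _)))
  | .or α β, m, hm => by
    have ihα := truth ht hT α hm
    have ihβ := truth ht hT β hm
    rw [sat_or_iff ⟨_, hT m hm⟩, not_or]
    refine ⟨?_, fun h => cfSub (cfAndI (ihα.2 h.1) (ihβ.2 h.2)) (negI ?_)⟩
    · rintro (h | h)
      · exact cfSub (ihα.1 h) (orI₁ (self _))
      · exact cfSub (ihβ.1 h) (orI₂ (self _))
    · have hn := self (A := A) (and (neg α) (neg β))
      exact orE (α := bot) (head (or α.lift β.lift) _)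
        (negE (head _ _) ((andE₁ hn).mono (by simp)))
        (negE (head _ _) ((andE₂ hn).mono (by simp)))
  | .cf n hn₀ α, m, hm => by
    have hbox : ∀ {L : Lang} (χ : Form σ L), cf n hn₀ χ = boxr n χ := fun χ => by
      rw [boxr, dif_neg hn₀]
    rw [hbox, sat_boxr, lift_boxr]
    by_cases hn : n.Consistent
    · have ih := truth ht hT α (hm.minus_add hn)
      rw [T.intervene_intervene hm hn]
      exact ⟨fun h => boxr_boxr hm hn (ih.1 (h hn)),
        fun h => boxr_neg_boxr hm hn (ih.2 fun h' => h fun _ => h')⟩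
    · refine ⟨fun _ => boxr_of_theorem (boxr_of_not_consistent hn) m, fun h => ?_⟩
      exact absurd (fun h' => absurd h' hn) h

/-- Completeness for the basic language in presence of a formula `Φ^F`. -/
theorem of_forall_isPoint (hF : Derives A Γ (Phi F)) {α β : Form σ Lang.co}
    (hα : Derives A Γ α.lift)
    (h : ∀ T : CausalTeam σ, T.F = F.reduce → T.IsPoint → α.Sat T → β.Sat T) :
    Derives A Γ β.lift := by
  refine of_forall_table fun Δ hΓΔ hΔ hv => ?_
  choose t ht using hv
  have hFΔ := hF.mono hΓΔ
  by_cases hrec : F.reduce.Recursive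
  · let T : CausalTeam σ :=
      { team := {t 0}
        F := F.reduce
        recursive := hrec
        compatible := by
          intro s hs V g hg
          rw [Set.mem_singleton_iff.mp hs]
          exact table_endogenous hΔ ht Eqns.consistent_zero hFΔ
            (fun ⟨x, hx⟩ => Multiset.notMem_zero _ hx) hg }
    have hT : ∀ m : Eqns σ, m.Consistent → (T.intervene m).team = {t m} := by
      intro m hm
      rw [table_eq_doAssign hΔ ht hm hFΔ hrec]
      exact Set.image_singleton
    have key : ∀ γ : Form σ Lang.co,
        (γ.Sat T → Derives A Δ γ.lift) ∧ (¬ γ.Sat T → Derives A Δ (neg γ)) := by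
      intro γ
      have := truth ht hT γ Eqns.consistent_zero
      rwa [T.intervene_zero, boxr, dif_pos rfl, boxr, dif_pos rfl] at this
    by_cases hsat : α.Sat T
    · exact (key β).1 (h T rfl ⟨_, rfl⟩ hsat)
    · exact negE (hα.mono hΓΔ) ((key α).2 hsat)
  · exact absurd (hFΔ.bot_of_not_recursive hrec) hΔ

/-- As there are finitely many causal teams, a consequence of `Γ` is already one of a single
formula derivable from `Γ`. -/
theorem exists_of_entailsC {ψ : Form σ Lang.cov} (h : EntailsC Γ ψ) :
    ∃ θ, Derives A Γ θ ∧ ∀ T : CausalTeam σ, θ.Sat T → ψ.Sat T := by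
  have key : ∀ l : List (CausalTeam σ),
      ∃ θ, Derives A Γ θ ∧ ∀ T ∈ l, θ.Sat T → ψ.Sat T := by
    intro l
    induction l with
    | nil => exact ⟨neg bot, negI (head _ _), by simp⟩
    | cons T l ih =>
      obtain ⟨θ, hθ, hl⟩ := ih
      by_cases hT : ψ.Sat T
      · refine ⟨θ, hθ, fun S hS => ?_⟩
        rcases List.mem_cons.mp hS with rfl | hS
        · exact fun _ => hT
        · exact hl S hS
      · obtain ⟨φ, hφ, hφT⟩ : ∃ φ ∈ Γ, ¬ φ.Sat T := by
          by_contra hcon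
          push Not at hcon
          exact hT (h T hcon)
        refine ⟨and φ θ, andI (hyp hφ) hθ, fun S hS hs => ?_⟩
        rcases List.mem_cons.mp hS with rfl | hS
        · exact absurd hs.1 hφT
        · exact hl S hS hs.2
  obtain ⟨θ, hθ, hl⟩ := key (enum _)
  exact ⟨θ, hθ, fun T => hl T (mem_enum T)⟩

end Derives

theorem DerivesC.entailsC {Γ : Set (Form σ Lang.cov)} {ψ : Form σ Lang.cov}
    (h : DerivesC Γ ψ) : EntailsC Γ ψ := fun _ hT =>
  Derives.sound h (by rintro _ rfl T; exact sat_unf T) hT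

open Derives in
theorem EntailsC.derivesC {Γ : Set (Form σ Lang.cov)} {ψ : Form σ Lang.cov}
    (h : EntailsC Γ ψ) : DerivesC Γ ψ := by
  obtain ⟨θ, hθ, hψ⟩ := exists_of_entailsC (A := {unf σ}) h
  obtain ⟨l, hl, hl₁, hl₂⟩ := exists_normalForm {unf σ} θ
  obtain ⟨k, hk, hk₁, hk₂⟩ := exists_normalForm {unf σ} ψ
  rw [lift_cov] at hl₂ hk₂
  simp only [lift_cov θ] at hl₁
  simp only [lift_cov ψ] at hk₁
  have hsound : ∀ {Γ : Set (Form σ Lang.cov)} {φ : Form σ Lang.cov} {T : CausalTeam σ},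
      DerivesC Γ φ → (∀ χ ∈ Γ, χ.Sat T) → φ.Sat T := fun h hT => h.entailsC _ hT
  refine listIdisj_elim (hθ.trans hl₂) fun a ha => ?_
  obtain ⟨α, hα, rfl⟩ := List.mem_map.mp ha
  refine listIdisj_elim (ax (Set.mem_singleton _)) fun χ hχ => ?_
  obtain ⟨F, -, rfl⟩ := List.mem_map.mp hχ
  by_cases hrec : F.reduce.Recursive
  · let U : CausalTeam σ :=
      { team := {s | F.reduce.Compatible s}
        F := F.reduce
        recursive := hrec
        compatible := fun s hs => hs }
    -- The largest team with the reduced system that satisfies `α`: as it satisfies a single disjunct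
    -- `β` of `ψ`, so does each of its subteams.
    let T : CausalTeam σ := U.restrict {s | ∃ hs, α.Sat (U.single s hs)}
    have hαT : α.Sat T := by
      refine sat_of_forall_single ?_
      rintro s ⟨_, hs, h⟩
      exact h
    have hψT : ψ.Sat T := hψ T <| hsound (hl₁ α hα) <| by
      rintro _ rfl
      exact sat_lift.mpr hαT
    have hkT : (listIdisj (k.map lift)).Sat T := hsound hk₂ <| by
      rintro _ rfl
      exact hψT
    obtain ⟨b, hb, hbT⟩ := exists_sat_of_sat_listIdisj (by simpa using hk) hkT
    obtain ⟨β, hβ, rfl⟩ := List.mem_map.mp hb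
    refine (of_forall_isPoint (F := F) (head _ _) ((head α.lift _).weaken _)
      (β := β) fun S hS hpoint hαS => ?_).trans (hk₁ β hβ)
    refine (sat_lift.mp hbT).mono ⟨fun s hs => ?_, hS⟩
    have hsU : s ∈ U.team := by
      have := S.compatible s hs
      rwa [hS] at this
    refine ⟨hsU, hsU, hαS.mono ⟨Set.singleton_subset_iff.mpr hs, hS.symm⟩⟩
  · exact ((head _ _).bot_of_not_recursive hrec).botE

end CausalLogic

theorem theorem5p7 (σ : CausalLogic.Signature.{u, v})
    (Γ : Set (CausalLogic.Form σ CausalLogic.Lang.cov))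
    (ψ : CausalLogic.Form σ CausalLogic.Lang.cov) :
    CausalLogic.EntailsC Γ ψ ↔ CausalLogic.DerivesC Γ ψ :=
  ⟨CausalLogic.EntailsC.derivesC, CausalLogic.DerivesC.entailsC⟩
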